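/- Let $X$ be an orbifold of dimension $2n$, that is, a Hausdorff, second countable topological space with a covering by open sets $U_i$ and uniformizing systems $(V_i, G_i, \pi_i)$: $V_i \subseteq \mathbb{R}^{2n}$ is open, $G_i$ is a finite group acting smoothly and effectively on $V_i$, and $\pi_i : V_i \to U_i$ is continuous and induces a homeomorphism $V_i/G_i \to U_i$. The systems are compatible: each point of $U_i \cap U_j$ has an open neighbourhood with a uniformizing system that admits injections (equivariant smooth open embeddings over $X$, together with a monomorphism of groups) into both $(V_i,G_i,\pi_i)$ and $(V_j,G_j,\pi_j)$. A $k$-form on $X$ is a family of smooth $G_i$-invariant $k$-forms on the $V_i$ that agree under pullback by injections of a common uniformizing system. With the exterior derivative $d$, computed in the charts, these spaces $\Omega^k(X)$ form a complex whose cohomology is denoted $H^k(X)$. Let $\omega \in \Omega^2(X)$ be a symplectic form on $X$: $d\omega = 0$ and $\omega$ is nondegenerate at each point of each $V_i$. Let $\star : \Omega^k(X) \to \Omega^{2n-k}(X)$ be the symplectic star operator $\star\xi = \iota_{\xi^\sharp}(\omega^n/n!)$, where $\xi \mapsto \xi^\sharp$ is the inverse of the algebra isomorphism from multivector fields to forms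 that extends $v \mapsto \omega(v,\cdot)$, and let $\delta\xi = (-1)^k \star d \star \xi$ for $\xi \in \Omega^k(X)$. A form $\xi$ is called (symplectically) harmonic if $d\xi = 0$ and $\delta\xi = 0$. Let $L : H^k(X) \to H^{k+2}(X)$ be the map $L[\xi] = [\omega\wedge\xi]$. Then the following two conditions are equivalent: 1. for each $k \ge 0$, every class in $H^k(X)$ is the class of a harmonic form; 2. for each $k \in \{0, 1, \ldots, n\}$ the map $L^k : H^{n-k}(X) \to H^{n+k}(X)$ is surjective. -/

import Mathlib

set_option maxSynthPendingDepth 3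

/-- The space `Λ^k E^*` of alternating `k`-forms on a real vector space `E`. -/
abbrev AltForm (E : Type*) [NormedAddCommGroup E] [NormedSpace ℝ E] (k : ℕ) : Type _ :=
  E [⋀^Fin k]→L[ℝ] ℝ

namespace AltForm

/-! ### Auxiliary facts on tuples and permutations -/

section Tuples

variable {S : Type*} {p q : ℕ}

theorem update_left (v : Fin (p + q) → S) (i : Fin p) (z : S) :
    (fun a => Function.update v (Fin.castAdd q i) z (Fin.castAdd q a)) =
        Function.update (fun a => v (Fin.castAdd q a)) i z ∧
      (fun a => Function.update v (Fin.castAdd q i) z (Fin.natAdd p a)) =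
        fun a => v (Fin.natAdd p a) := by
  constructor
  · ext1 a
    simp [Function.update_apply]
  · ext1 a
    exact Function.update_of_ne (by simp [Fin.ext_iff]; omega) _ _

theorem update_right (v : Fin (p + q) → S) (i : Fin q) (z : S) :
    (fun a => Function.update v (Fin.natAdd p i) z (Fin.natAdd p a)) =
        Function.update (fun a => v (Fin.natAdd p a)) i z ∧
      (fun a => Function.update v (Fin.natAdd p i) z (Fin.castAdd q a)) =
        fun a => v (Fin.castAdd q a) := by
  constructor
  · ext1 a
    simp [Function.update_apply]
  · ext1 a
    exact Function.update_of_ne (by simp [Fin.ext_iff]; omega) _ _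

theorem append_update_left (v : Fin p → S) (w : Fin q → S) (i : Fin p) (z : S) :
    Fin.append (Function.update v i z) w =
      Function.update (Fin.append v w) (Fin.castAdd q i) z := by
  ext1 a
  refine Fin.addCases (fun a => ?_) (fun a => ?_) a
  · simp [Function.update_apply]
  · rw [Fin.append_right, Function.update_of_ne (by simp [Fin.ext_iff]; omega), Fin.append_right]

theorem append_update_right (v : Fin p → S) (w : Fin q → S) (i : Fin q) (z : S) :
    Fin.append v (Function.update w i z) =
      Function.update (Fin.append v w) (Fin.natAdd p i) z := by
  ext1 a
  refine Fin.addCases (fun a => ?_) (fun a => ?_) a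
  · rw [Fin.append_left, Function.update_of_ne (by simp [Fin.ext_iff]; omega), Fin.append_left]
  · simp [Function.update_apply]

theorem sum_perm_succ {n : ℕ} (F : S → (Fin n → S) → ℝ)
    (v : Fin (n + 1) → S) :
    ∑ σ : Equiv.Perm (Fin (n + 1)), ((Equiv.Perm.sign σ : ℤ) : ℝ) *
        F (v (σ 0)) (fun i => v (σ i.succ)) =
      ∑ a : Fin (n + 1), (-1) ^ (a : ℕ) * ∑ τ : Equiv.Perm (Fin n),
        ((Equiv.Perm.sign τ : ℤ) : ℝ) * F (v a) (fun i => a.removeNth v (τ i)) := by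
  simp only [Finset.mul_sum]
  rw [← Fintype.sum_prod_type']
  symm
  let e : Fin (n + 1) × Equiv.Perm (Fin n) → Equiv.Perm (Fin (n + 1)) := fun x =>
    x.1.cycleRange.symm * Equiv.Perm.decomposeFin.symm (0, x.2)
  have e0 : ∀ x, e x 0 = x.1 := fun x => by simp [e]
  have es : ∀ x i, e x (Fin.succ i) = x.1.succAbove (x.2 i) := fun x i => by simp [e]
  have inj : Function.Injective e := by
    rintro ⟨a, τ⟩ ⟨b, τ'⟩ h
    have h1 : a = b := by simpa [e0] using congrArg (fun s => s 0) h
    subst h1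
    simpa [e] using h
  have bij : Function.Bijective e :=
    (Fintype.bijective_iff_injective_and_card e).2 ⟨inj, by
      simp [Fintype.card_perm, Nat.factorial_succ]⟩
  refine Fintype.sum_bijective e bij _ _ fun x => ?_
  have hs : ((Equiv.Perm.sign (e x) : ℤ) : ℝ) =
      (-1) ^ (x.1 : ℕ) * ((Equiv.Perm.sign x.2 : ℤ) : ℝ) := by
    have : Equiv.Perm.sign x.1.cycleRange.symm = (-1) ^ (x.1 : ℕ) := by
      rw [Equiv.Perm.sign_symm, Fin.sign_cycleRange]
    simp only [e, Equiv.Perm.sign_mul, this, Equiv.Perm.decomposeFin.symm_sign]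
    simp
  simp only [e0, es, hs, mul_assoc]
  rfl

end Tuples

theorem update_two {S : Type*} [AddCommGroup S] (u w : S) : Function.update ![u, 0] 1 w = ![u, w] := by
  ext1 i
  fin_cases i <;> simp

/-! ### Forms and the wedge product -/

variable {E E' : Type*} [NormedAddCommGroup E] [NormedSpace ℝ E]
  [NormedAddCommGroup E'] [NormedSpace ℝ E'] {p q r : ℕ}

theorem finiteDimensional [FiniteDimensional ℝ E] (k : ℕ) : FiniteDimensional ℝ (AltForm E k) :=
  Module.Finite.of_injective
    ({ toFun := fun α => α.toMultilinearMap
       map_add' := fun _ _ => rfl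
       map_smul' := fun _ _ => rfl } :
      AltForm E k →ₗ[ℝ] MultilinearMap ℝ (fun _ : Fin k => E) ℝ)
    (fun _ _ h => ContinuousAlternatingMap.ext fun v =>
      congrArg (fun f : MultilinearMap ℝ (fun _ : Fin k => E) ℝ => f v) h)

instance [FiniteDimensional ℝ E] (k : ℕ) : FiniteDimensional ℝ (AltForm E k) :=
  finiteDimensional k

/-- The tensor product `(α ⊗ β)(v₁, …, v_r) = α(v₁, …, v_p) β(v_{p+1}, …, v_r)`, `r = p + q`. -/
def tensor (h : p + q = r) (α : AltForm E p) (β : AltForm E q) :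
    ContinuousMultilinearMap ℝ (fun _ : Fin r => E) ℝ where
  toFun v := α (fun i => v (Fin.cast h (Fin.castAdd q i))) *
    β (fun j => v (Fin.cast h (Fin.natAdd p j)))
  map_update_add' := by
    intro inst v i x y
    subst h
    obtain rfl : inst = instDecidableEqFin _ := Subsingleton.elim _ _
    refine Fin.addCases (fun i => ?_) (fun i => ?_) i
    · simp only [Fin.cast_refl, id, update_left, ContinuousAlternatingMap.map_update_add, add_mul]
    · simp only [Fin.cast_refl, id, update_right, ContinuousAlternatingMap.map_update_add, mul_add]
  map_update_smul' := by
    intro inst v i c x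
    subst h
    obtain rfl : inst = instDecidableEqFin _ := Subsingleton.elim _ _
    refine Fin.addCases (fun i => ?_) (fun i => ?_) i
    · simp only [Fin.cast_refl, id, update_left, ContinuousAlternatingMap.map_update_smul,
        smul_eq_mul, mul_assoc]
    · simp only [Fin.cast_refl, id, update_right, ContinuousAlternatingMap.map_update_smul,
        smul_eq_mul, mul_left_comm]
  cont := (α.coe_continuous.comp (by fun_prop)).mul (β.coe_continuous.comp (by fun_prop))

/-- The wedge product
`(α ∧ β)(v₁, …, v_r) = 1 / (p! q!) ∑_σ sgn(σ) α(v_{σ 1}, …, v_{σ p}) β(v_{σ (p+1)}, …, v_{σ r})`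
of a `p`-form and a `q`-form, where `r = p + q`. -/
noncomputable def wedge (h : p + q = r) (α : AltForm E p) (β : AltForm E q) : AltForm E r :=
  ((p.factorial * q.factorial : ℝ)⁻¹) • (tensor h α β).alternatization

theorem wedge_apply (h : p + q = r) (α : AltForm E p) (β : AltForm E q) (v : Fin r → E) :
    wedge h α β v = (p.factorial * q.factorial : ℝ)⁻¹ *
      ∑ σ : Equiv.Perm (Fin r), ((Equiv.Perm.sign σ : ℤ) : ℝ) *
        (α (fun i => v (σ (Fin.cast h (Fin.castAdd q i)))) *
          β (fun j => v (σ (Fin.cast h (Fin.natAdd p j))))) := by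
  simp only [wedge, ContinuousAlternatingMap.smul_apply,
    ContinuousMultilinearMap.alternatization_apply_apply, smul_eq_mul]
  congr 1
  refine Finset.sum_congr rfl fun σ _ => ?_
  rw [Units.smul_def, zsmul_eq_mul]
  rfl

theorem wedge_pullback (h : p + q = r) (α : AltForm E p) (β : AltForm E q)
    (f : E' →L[ℝ] E) :
    (wedge h α β).compContinuousLinearMap f =
      wedge h (α.compContinuousLinearMap f) (β.compContinuousLinearMap f) := by
  ext v
  simp only [ContinuousAlternatingMap.compContinuousLinearMap_apply, wedge_apply]
  rfl

/-- The wedge product as a continuous bilinear map. -/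
noncomputable def wedgeL [FiniteDimensional ℝ E] (h : p + q = r) :
    AltForm E p →L[ℝ] AltForm E q →L[ℝ] AltForm E r :=
  (LinearMap.mk₂ ℝ (wedge h)
    (fun a b c => by
      ext v; simp only [ContinuousAlternatingMap.add_apply, wedge_apply, add_mul, mul_add,
        Finset.sum_add_distrib])
    (fun c a b => by
      ext v; simp only [ContinuousAlternatingMap.smul_apply, wedge_apply, smul_eq_mul,
        Finset.mul_sum]
      exact Finset.sum_congr rfl fun _ _ => by ring)
    (fun a b c => by
      ext v; simp only [ContinuousAlternatingMap.add_apply, wedge_apply, mul_add,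
        Finset.sum_add_distrib])
    (fun c a b => by
      ext v; simp only [ContinuousAlternatingMap.smul_apply, wedge_apply, smul_eq_mul,
        Finset.mul_sum]
      exact Finset.sum_congr rfl fun _ _ => by ring)).toContinuousBilinearMap

@[simp] theorem wedgeL_apply [FiniteDimensional ℝ E] (h : p + q = r) (α : AltForm E p) (β : AltForm E q) :
    wedgeL h α β = wedge h α β := rfl


/-! ### The Leibniz rule for the product with a closed `2`-form -/

theorem sum_perm_comp {n : ℕ} (β : AltForm E n) (w : Fin n → E) :
    ∑ τ : Equiv.Perm (Fin n), ((Equiv.Perm.sign τ : ℤ) : ℝ) * β (fun i => w (τ i)) =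
      n.factorial * β w := by
  have : ∀ τ : Equiv.Perm (Fin n),
      ((Equiv.Perm.sign τ : ℤ) : ℝ) * β (fun i => w (τ i)) = β w := fun τ => by
    have := β.toAlternatingMap.map_perm w τ
    change β (fun i => w (τ i)) = _ at this
    rw [this, Units.smul_def, zsmul_eq_mul, ← mul_assoc, ← Int.cast_mul, ← Units.val_mul]
    simp
  simp [this, Fintype.card_perm]

open ContinuousAlternatingMap in
/-- Alternatization of `(u, w, v₁, …) ↦ B u w (v₁, …)`. -/
noncomputable def alt₂ {l : ℕ} (B : E →L[ℝ] E →L[ℝ] AltForm E l) : AltForm E (l + 2) :=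
  alternatizeUncurryFin (alternatizeUncurryFinCLM ℝ E ℝ ∘L B)

open ContinuousAlternatingMap in
theorem alt₂_apply {l : ℕ} (B : E →L[ℝ] E →L[ℝ] AltForm E l)
    (v : Fin (l + 2) → E) :
    alt₂ B v = ∑ a : Fin (l + 2), (-1) ^ (a : ℕ) * ∑ b : Fin (l + 1), (-1) ^ (b : ℕ) *
      B (v a) (a.removeNth v b) (b.removeNth (a.removeNth v)) := by
  simp [alt₂, alternatizeUncurryFin_apply]

open ContinuousAlternatingMap in
theorem alt₂_flip {l : ℕ} (B : E →L[ℝ] E →L[ℝ] AltForm E l) :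
    alt₂ B.flip = -alt₂ B := by
  have h : alt₂ (B + B.flip) = 0 :=
    alternatizeUncurryFin_alternatizeUncurryFinCLM_comp_of_symmetric fun x y => by
      simp [add_comm]
  have h2 : alt₂ (B + B.flip) = alt₂ B + alt₂ B.flip := by
    simp [alt₂, alternatizeUncurryFin_add]
  rw [h2] at h
  exact (neg_eq_of_add_eq_zero_right h).symm

/-- The bilinear form underlying a `2`-form. -/
noncomputable def bil [FiniteDimensional ℝ E] : AltForm E 2 →L[ℝ] E →L[ℝ] E →L[ℝ] ℝ :=
  LinearMap.toContinuousBilinearMap <| LinearMap.mk₂ ℝ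
    (fun ω u => ω.toContinuousLinearMap ![u, 0] 1)
    (fun a b u => by ext; simp)
    (fun c a u => by ext; simp)
    (fun a u u' => by
      ext w
      simpa [update_two] using a.vecCons_add ![w] u u')
    (fun c a u => by
      ext w
      simpa [update_two] using a.vecCons_smul ![w] c u)

theorem bil_apply [FiniteDimensional ℝ E] (ω : AltForm E 2) (u w : E) :
    bil ω u w = ω ![u, w] := by
  simp [bil, update_two]

/-- `(u, w) ↦ B(u, w) y`. -/
noncomputable def tmul {Y : Type*} [NormedAddCommGroup Y] [NormedSpace ℝ Y]
    (B : E →L[ℝ] E →L[ℝ] ℝ) (y : Y) : E →L[ℝ] E →L[ℝ] Y :=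
  (ContinuousLinearMap.smulRightL ℝ E Y).flip y ∘L B

@[simp] theorem tmul_apply {Y : Type*} [NormedAddCommGroup Y] [NormedSpace ℝ Y]
    (B : E →L[ℝ] E →L[ℝ] ℝ) (y : Y) (u w : E) : tmul B y u w = B u w • y := by
  simp [tmul]

theorem wedge_two [FiniteDimensional ℝ E] {l : ℕ} (h : 2 + l = l + 2) (ω : AltForm E 2) (β : AltForm E l) :
    wedge h ω β = (2 : ℝ)⁻¹ • alt₂ (tmul (bil ω) β) := by
  ext v
  have key := sum_perm_succ (fun u w => ∑ b : Fin (l + 1), (-1) ^ (b : ℕ) *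
      (ω ![u, w b] * β (b.removeNth w))) v
  rw [wedge_apply, ContinuousAlternatingMap.smul_apply, alt₂_apply, smul_eq_mul]
  have h1 : ∀ σ : Equiv.Perm (Fin (l + 2)),
      ω (fun i => v (σ (Fin.cast h (Fin.castAdd l i)))) *
          β (fun j => v (σ (Fin.cast h (Fin.natAdd 2 j)))) =
        ω ![v (σ 0), v (σ (Fin.succ 0))] * β (fun j => v (σ (Fin.succ (Fin.succ j)))) := by
    intro σ
    congr 2
    · ext1 i
      fin_cases i <;> rfl
    · ext1 j
      congr 2
      ext
      simp
  simp only [h1]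
  rw [sum_perm_succ (fun u w => ω ![u, w 0] * β (fun j => w (Fin.succ j))) v]
  have h2 : ∀ a : Fin (l + 2), ∑ τ : Equiv.Perm (Fin (l + 1)), ((Equiv.Perm.sign τ : ℤ) : ℝ) *
      (ω ![v a, a.removeNth v (τ 0)] * β (fun j => a.removeNth v (τ j.succ))) =
      l.factorial * ∑ b : Fin (l + 1), (-1) ^ (b : ℕ) *
        (ω ![v a, a.removeNth v b] * β (b.removeNth (a.removeNth v))) := by
    intro a
    rw [sum_perm_succ (fun u w => ω ![v a, u] * β w) (a.removeNth v), Finset.mul_sum]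
    refine Finset.sum_congr rfl fun b _ => ?_
    simp only [mul_left_comm _ (ω _), ← Finset.mul_sum, sum_perm_comp]
    ring
  simp only [h2, tmul_apply, bil_apply, ContinuousAlternatingMap.smul_apply, smul_eq_mul]
  simp only [Finset.mul_sum]
  refine Finset.sum_congr rfl fun a _ => Finset.sum_congr rfl fun b _ => ?_
  have : (l.factorial : ℝ) ≠ 0 := by positivity
  simp
  field_simp

open ContinuousAlternatingMap in
/-- Alternatization of `(u, v, w, v₁, …) ↦ T u v w (v₁, …)`. -/
noncomputable def alt₃ {l : ℕ}
    (T : E →L[ℝ] E →L[ℝ] E →L[ℝ] AltForm E l) : AltForm E (l + 3) :=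
  alt₂ (ContinuousLinearMap.compL ℝ E (E →L[ℝ] AltForm E l) (AltForm E (l + 1))
    (alternatizeUncurryFinCLM ℝ E ℝ) ∘L T)

open ContinuousAlternatingMap in
theorem alt₃_eq {l : ℕ} (T : E →L[ℝ] E →L[ℝ] E →L[ℝ] AltForm E l)
    (f : E →L[ℝ] AltForm E (l + 2)) (h : ∀ u, f u = alt₂ (T u)) :
    alt₃ T = alternatizeUncurryFin f := by
  rw [alt₃, alt₂]
  congr 1
  ext1 u
  rw [h]
  rfl

theorem alt₃_flip {l : ℕ} (T : E →L[ℝ] E →L[ℝ] E →L[ℝ] AltForm E l) :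
    alt₃ T.flip = -alt₃ T := by
  rw [alt₃, alt₃, ← alt₂_flip]
  rfl

theorem alt₃_congr_flip {l : ℕ} (T T' : E →L[ℝ] E →L[ℝ] E →L[ℝ] AltForm E l)
    (h : ∀ u v w, T' u v w = T u w v) : alt₃ T' = -alt₃ T := by
  have h' : ∀ u, T' u = (T u).flip := fun u => by
    ext1 v; ext1 w; simp [h]
  rw [alt₃, alt₃]
  simp only [alt₂]
  rw [← ContinuousAlternatingMap.alternatizeUncurryFinCLM_apply,
    ← ContinuousAlternatingMap.alternatizeUncurryFinCLM_apply, ← map_neg]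
  congr 1
  ext1 u
  change alt₂ (T' u) = -alt₂ (T u)
  rw [h', alt₂_flip]


theorem alt₃_add {l : ℕ} (T T' : E →L[ℝ] E →L[ℝ] E →L[ℝ] AltForm E l) :
    alt₃ (T + T') = alt₃ T + alt₃ T' := by
  simp only [alt₃, alt₂, ContinuousLinearMap.comp_add,
    ContinuousAlternatingMap.alternatizeUncurryFin_add]

/-- Exchange of the last two of three arguments. -/
noncomputable def flipIn {l : ℕ} (T : E →L[ℝ] E →L[ℝ] E →L[ℝ] AltForm E l) :
    E →L[ℝ] E →L[ℝ] E →L[ℝ] AltForm E l :=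
  (ContinuousLinearMap.flipₗᵢ ℝ E E (AltForm E l)).toContinuousLinearEquiv.toContinuousLinearMap ∘L T

theorem flipIn_apply {l : ℕ} (T : E →L[ℝ] E →L[ℝ] E →L[ℝ] AltForm E l) (u v w : E) :
    flipIn T u v w = T u w v := rfl

theorem alt₃_flipIn {l : ℕ} (T : E →L[ℝ] E →L[ℝ] E →L[ℝ] AltForm E l) :
    alt₃ (flipIn T) = -alt₃ T :=
  alt₃_congr_flip _ _ fun _ _ _ => rfl

open ContinuousAlternatingMap in
/-- `d(ω ∧ β) = ω ∧ dβ` if `dω = 0`. -/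
theorem extDeriv_wedge [FiniteDimensional ℝ E] {l : ℕ} {ω : E → AltForm E 2} {β : E → AltForm E l}
    {x : E} (hω : DifferentiableAt ℝ ω x) (hβ : DifferentiableAt ℝ β x)
    (hc : extDeriv ω x = 0) (h : 2 + l = l + 2) (h' : 2 + (l + 1) = l + 1 + 2) :
    extDeriv (fun y => wedge h (ω y) (β y)) x = wedge h' (ω x) (extDeriv β x) := by
  set ω' := fderiv ℝ ω x with hω'
  set β' := fderiv ℝ β x with hβ'
  have hd := (wedgeL (E := E) h).hasFDerivAt_of_bilinear hω.hasFDerivAt hβ.hasFDerivAt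
  have hd' : fderiv ℝ (fun y => wedge h (ω y) (β y)) x = _ := hd.fderiv
  let S : E →L[ℝ] E →L[ℝ] E →L[ℝ] AltForm E l := tmul (bil (ω x)) β'
  let T₁ : E →L[ℝ] E →L[ℝ] E →L[ℝ] AltForm E l :=
    (ContinuousLinearMap.compL ℝ E (E →L[ℝ] ℝ) (E →L[ℝ] AltForm E l)
      ((ContinuousLinearMap.smulRightL ℝ E (AltForm E l)).flip (β x))) ∘L bil ∘L ω'
  have hT₁ : ∀ u v w, T₁ u v w = ω' u ![v, w] • β x := fun u v w => by
    simp [T₁, bil_apply]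
  have h0 : alt₃ T₁ = 0 := by
    have e1 : T₁ + flipIn T₁.flip = T₁.flip := by
      ext1 u; ext1 v; ext1 w
      have : extDeriv ω x ![u, v, w] = 0 := by rw [hc]; rfl
      rw [extDeriv_apply hω] at this
      have hf : ∀ (a : Fin 2 → E) (b : E), fderiv ℝ (fun y => ω y a) x b = ω' b a := fun a b =>
        fderiv_continuousAlternatingMap_apply_const_apply hω _ _
      simp only [hf] at this
      replace this := (Fin.sum_univ_three _).symm.trans this
      have r0 : (0 : Fin 3).removeNth ![u, v, w] = ![v, w] := by
        ext1 i; fin_cases i <;> rfl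
      have r1 : (1 : Fin 3).removeNth ![u, v, w] = ![u, w] := by
        ext1 i; fin_cases i <;> rfl
      have r2 : (2 : Fin 3).removeNth ![u, v, w] = ![u, v] := by
        ext1 i; fin_cases i <;> rfl
      rw [r0, r1, r2] at this
      simp only [Int.reduceNeg, Nat.reduceAdd, Fin.isValue, Fin.coe_ofNat_eq_mod, Nat.zero_mod,
        pow_zero, Matrix.cons_val_zero, Nat.succ_eq_add_one, one_smul, Nat.one_mod, pow_one,
        Matrix.cons_val_one, neg_smul, Nat.mod_succ, even_two, Even.neg_pow, one_pow,
        Matrix.cons_val] at this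
      change T₁ u v w + T₁ w u v = T₁ v u w
      rw [hT₁, hT₁, hT₁, ← add_smul]
      congr 1
      linarith
    have e2 : alt₃ T₁ + alt₃ T₁ = - alt₃ T₁ := by
      conv_rhs => rw [← alt₃_flip, ← e1, alt₃_add, alt₃_flipIn, alt₃_flip, neg_neg]
    have e3 : (3 : ℝ) • alt₃ T₁ = 0 := by
      have : (3 : ℝ) • alt₃ T₁ = alt₃ T₁ + alt₃ T₁ + alt₃ T₁ := by module
      rw [this, e2]; simp
    exact (smul_eq_zero.1 e3).resolve_left (by norm_num)
  have k₁ : alternatizeUncurryFin ((wedgeL (E := E) h).precompL E ω' (β x)) = 0 := by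
    have := alt₃_eq T₁ ((2 : ℝ) • (wedgeL (E := E) h).precompL E ω' (β x)) fun u => by
      change (2 : ℝ) • wedge h (ω' u) (β x) = _
      rw [wedge_two, smul_smul, mul_inv_cancel₀ two_ne_zero, one_smul]
      rfl
    rw [h0, alternatizeUncurryFin_smul] at this
    exact (smul_eq_zero.1 this.symm).resolve_left (by norm_num)
  have k₂ : alternatizeUncurryFin ((wedgeL (E := E) h).precompR E (ω x) β') =
      (2 : ℝ)⁻¹ • alt₃ S := by
    have := alt₃_eq (flipIn S).flip ((2 : ℝ) • (wedgeL (E := E) h).precompR E (ω x) β') fun u => by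
      change (2 : ℝ) • wedge h (ω x) (β' u) = _
      rw [wedge_two, smul_smul, mul_inv_cancel₀ two_ne_zero, one_smul]
      rfl
    rw [alt₃_flip, alt₃_flipIn, neg_neg, alternatizeUncurryFin_smul] at this
    rw [this, smul_smul]
    norm_num
  rw [extDeriv, hd', alternatizeUncurryFin_add, k₁, k₂, wedge_two, add_zero]
  congr 1
  rw [alt₃]
  congr 1
  ext1 u; ext1 v
  simp [S]
  rfl

/-! ### The symplectic star operator -/

/-- `ι_{v₁ ∧ … ∧ v_p} η = η(v₁, …, v_p, ·, …, ·)`. -/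
def contractVec (h : p + q = r) (η : AltForm E r) (v : Fin p → E) : AltForm E q where
  toFun w := η (fun i => Fin.append v w (Fin.cast h.symm i))
  map_update_add' := by
    intro inst w i x y
    subst h
    obtain rfl : inst = instDecidableEqFin _ := Subsingleton.elim _ _
    simp [append_update_right]
  map_update_smul' := by
    intro inst w i c x
    subst h
    obtain rfl : inst = instDecidableEqFin _ := Subsingleton.elim _ _
    simp [append_update_right]
  map_eq_zero_of_eq' := by
    intro w i j hij hne
    subst h
    exact η.map_eq_zero_of_eq _ (i := Fin.natAdd p i) (j := Fin.natAdd p j) (by simpa using hij)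
      (by simpa [Fin.ext_iff] using hne)
  cont := by
    subst h
    refine η.coe_continuous.comp (continuous_pi fun a => ?_)
    refine Fin.addCases (fun a => ?_) (fun a => ?_) a
    · simpa using continuous_const
    · simpa using continuous_apply a

theorem contractVec_apply (h : p + q = r) (η : AltForm E r) (v : Fin p → E) (w : Fin q → E) :
    contractVec h η v w = η (fun i => Fin.append v w (Fin.cast h.symm i)) := rfl

/-- The contraction `⋀^p E ∋ X ↦ ι_X η ∈ Λ^{r-p} E^*` of multivectors with a fixed form `η`. -/
noncomputable def contract (h : p + q = r) (η : AltForm E r) : ⋀[ℝ]^p E →ₗ[ℝ] AltForm E q :=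
  exteriorPower.alternatingMapLinearEquiv
    { toFun := contractVec h η
      map_update_add' := by
        intro inst v i x y
        subst h
        obtain rfl : inst = instDecidableEqFin _ := Subsingleton.elim _ _
        ext w
        simp [contractVec_apply, append_update_left]
      map_update_smul' := by
        intro inst v i c x
        subst h
        obtain rfl : inst = instDecidableEqFin _ := Subsingleton.elim _ _
        ext w
        simp [contractVec_apply, append_update_left]
      map_eq_zero_of_eq' := by
        intro v i j hij hne
        subst h
        ext w
        exact η.map_eq_zero_of_eq _ (i := Fin.castAdd q i) (j := Fin.castAdd q j)
          (by simpa using hij) (by simpa [Fin.ext_iff] using hne) }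

theorem contract_ιMulti (h : p + q = r) (η : AltForm E r) (v : Fin p → E) (w : Fin q → E) :
    contract h η (exteriorPower.ιMulti ℝ p v) w =
      η (fun i => Fin.append v w (Fin.cast h.symm i)) := by
  simp [contract, contractVec_apply]

/-- Nondegeneracy of a `2`-form: `ω(v, ·) = 0` only for `v = 0`. -/
def Nondegenerate (ω : AltForm E 2) : Prop :=
  ∀ v : E, (∀ w : E, ω ![v, w] = 0) → v = 0

variable [FiniteDimensional ℝ E]

/-- `ω♭v₁ ∧ … ∧ ω♭v_p`, where `ω♭v = ω(v, ·)`; its value on `(u₁, …, u_p)` is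
`det (ω(v_i, u_j))`. -/
noncomputable def flatVec (ω : AltForm E 2) (v : Fin p → E) : AltForm E p where
  toAlternatingMap := Matrix.detRowAlternating.compLinearMap
    (LinearMap.pi fun i => (bil ω (v i)).toLinearMap)
  cont := by
    change Continuous fun u : Fin p → E => (Matrix.of fun j i => bil ω (v i) (u j)).det
    fun_prop

theorem flatVec_apply (ω : AltForm E 2) (v u : Fin p → E) :
    flatVec ω v u = (Matrix.of fun i j => ω ![v i, u j]).det := by
  rw [← Matrix.det_transpose]
  simp only [← bil_apply]
  rfl

theorem flatVec_apply' (ω : AltForm E 2) (v u : Fin p → E) :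
    flatVec ω v u = Matrix.detRowAlternating.compLinearMap
      (LinearMap.pi fun j => ((bil ω).flip (u j)).toLinearMap) v := by
  rw [flatVec_apply]
  simp only [← bil_apply]
  rfl

/-- The extension `⋀^p E → Λ^p E^*` of `v ↦ ω(v, ·)` to an algebra homomorphism, in degree `p`. -/
noncomputable def flat (ω : AltForm E 2) (p : ℕ) : ⋀[ℝ]^p E →ₗ[ℝ] AltForm E p :=
  exteriorPower.alternatingMapLinearEquiv
    { toFun := flatVec ω
      map_update_add' := by
        intro inst v i x y
        ext u
        simp only [ContinuousAlternatingMap.add_apply, flatVec_apply', AlternatingMap.map_update_add]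
      map_update_smul' := by
        intro inst v i c x
        ext u
        simp only [ContinuousAlternatingMap.smul_apply, flatVec_apply',
          AlternatingMap.map_update_smul]
      map_eq_zero_of_eq' := by
        intro v i j hij hne
        ext u
        rw [flatVec_apply', AlternatingMap.map_eq_zero_of_eq _ _ hij hne]
        rfl }

theorem flat_ιMulti (ω : AltForm E 2) (v u : Fin p → E) :
    flat ω p (exteriorPower.ιMulti ℝ p v) u = (Matrix.of fun i j => ω ![v i, u j]).det := by
  simp [flat, flatVec_apply]

/-- For a nondegenerate `ω` the map `flat` is an isomorphism. -/
theorem flat_bijective {ω : AltForm E 2} (hω : Nondegenerate ω) (p : ℕ) :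
    Function.Bijective (flat ω p) := by
  let b := Module.finBasis ℝ E
  let B : E →ₗ[ℝ] Module.Dual ℝ E := ContinuousLinearMap.coeLM ℝ ∘ₗ (bil ω).toLinearMap
  have hB : ∀ v w, B v w = ω ![v, w] := fun v w => bil_apply ω v w
  have hinj : Function.Injective B := (injective_iff_map_eq_zero B).2 fun v hv =>
    hω v fun w => by rw [← hB, hv]; rfl
  let e : E ≃ₗ[ℝ] Module.Dual ℝ E :=
    LinearEquiv.ofInjectiveOfFinrankEq B hinj Subspace.dual_finrank_eq.symm
  have he : ∀ v w, e v w = ω ![v, w] := hB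
  let s := b.dualBasis.map e.symm
  have hs : ∀ i u, ω ![s i, u] = b.coord i u := fun i u => by
    rw [← he]; simp [s]
  have hs' : ∀ j v, s.coord j v = ω ![v, b j] := fun j v => by
    rw [← he]
    simp [s, Module.Basis.map]
  constructor
  · rw [injective_iff_map_eq_zero]
    intro X hX
    have key : ∀ J, exteriorPower.ιMultiDual ℝ p s J X =
        flat ω p X (fun j => b (Set.powersetCard.ofFinEmbEquiv.symm J j)) := by
      intro J
      let ev : AltForm E p →ₗ[ℝ] ℝ :=
        { toFun := fun α => α (fun j => b (Set.powersetCard.ofFinEmbEquiv.symm J j))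
          map_add' := fun _ _ => rfl
          map_smul' := fun _ _ => rfl }
      have : exteriorPower.ιMultiDual ℝ p s J = ev ∘ₗ flat ω p := by
        refine exteriorPower.linearMap_ext (AlternatingMap.ext fun v => ?_)
        change exteriorPower.ιMultiDual ℝ p s J (exteriorPower.ιMulti ℝ p v) =
          flat ω p (exteriorPower.ιMulti ℝ p v) _
        rw [exteriorPower.ιMultiDual_apply_ιMulti, flat_ιMulti]
        simp only [hs']
      rw [this]
      rfl
    refine (s.exteriorPower p).ext_elem fun J => ?_
    rw [exteriorPower.basis_repr_apply, key, hX]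
    simp
  · intro α
    refine ⟨((p.factorial : ℝ)⁻¹) • ∑ I : Fin p → Fin (Module.finrank ℝ E),
      α (fun a => b (I a)) • exteriorPower.ιMulti ℝ p (fun a => s (I a)), ?_⟩
    ext u
    have h1 : ∀ w : Fin p → E, α w = ∑ I : Fin p → Fin (Module.finrank ℝ E),
        (∏ a, b.coord (I a) (w a)) * α (fun a => b (I a)) := fun w => by
      conv_lhs => rw [show w = fun a => ∑ j, b.coord j (w a) • b j from
        funext fun a => (b.sum_repr (w a)).symm]
      change α.toMultilinearMap _ = _
      rw [MultilinearMap.map_sum]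
      refine Finset.sum_congr rfl fun I _ => ?_
      rw [MultilinearMap.map_smul_univ]
      rfl
    have h2 : ∀ I : Fin p → Fin (Module.finrank ℝ E),
        flat ω p (exteriorPower.ιMulti ℝ p (fun a => s (I a))) u =
          ∑ σ : Equiv.Perm (Fin p), ((Equiv.Perm.sign σ : ℤ) : ℝ) *
            ∏ a, b.coord (I a) (u (σ a)) := fun I => by
      rw [flat_ιMulti, ← Matrix.det_transpose, Matrix.det_apply']
      refine Finset.sum_congr rfl fun σ _ => ?_
      simp [hs]
    simp only [map_smul, map_sum, ContinuousAlternatingMap.smul_apply,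
      ContinuousAlternatingMap.sum_apply, smul_eq_mul, h2]
    have h3 : ∑ I : Fin p → Fin (Module.finrank ℝ E), α (fun a => b (I a)) *
        ∑ σ : Equiv.Perm (Fin p), ((Equiv.Perm.sign σ : ℤ) : ℝ) *
            ∏ a, b.coord (I a) (u (σ a)) = p.factorial * α u := by
      rw [← sum_perm_comp]
      simp only [Finset.mul_sum, h1 (fun a => u (_))]
      rw [Finset.sum_comm]
      exact Finset.sum_congr rfl fun σ _ => Finset.sum_congr rfl fun I _ => by ring
    rw [h3, inv_mul_cancel_left₀ (by positivity)]

/-- The isomorphism `Λ^p E^* → ⋀^p E` inverse to `flat`, for nondegenerate `ω`. -/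
noncomputable def sharp (ω : AltForm E 2) (α : AltForm E p) : ⋀[ℝ]^p E :=
  Function.invFun (flat ω p) α

theorem flat_sharp {ω : AltForm E 2} (hω : Nondegenerate ω) (α : AltForm E p) :
    flat ω p (sharp ω α) = α :=
  Function.rightInverse_invFun (flat_bijective hω p).2 α

theorem sharp_flat {ω : AltForm E 2} (hω : Nondegenerate ω) (X : ⋀[ℝ]^p E) :
    sharp ω (flat ω p X) = X :=
  Function.leftInverse_invFun (flat_bijective hω p).1 X

/-- The power `ω^j = ω ∧ … ∧ ω`. -/
noncomputable def pow (ω : AltForm E 2) : (j : ℕ) → AltForm E (2 * j)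
  | 0 => ContinuousAlternatingMap.constOfIsEmpty ℝ E (Fin 0) 1
  | j + 1 => wedge (Nat.add_comm 2 (2 * j)) ω (pow ω j)

/-- The Liouville volume form `ω^n / n!`. -/
noncomputable def vol (n : ℕ) (ω : AltForm E 2) : AltForm E (2 * n) :=
  (n.factorial : ℝ)⁻¹ • pow ω n

/-- The symplectic star operator `Λ^p E^* ≅ ⋀^p E ≅ Λ^{2n-p} E^*` of a symplectic vector space of
dimension `2n`, composed of `sharp` and of `X ↦ ι_X (ω^n / n!)`. -/
noncomputable def star (n : ℕ) (h : p + q = 2 * n) (ω : AltForm E 2) (α : AltForm E p) :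
    AltForm E q :=
  contract h (vol n ω) (sharp ω α)

/-- The codifferential `δξ = (-1)^k ⋆ d ⋆ ξ` at the point `x` of a form `ξ` of positive degree
`k = j + 1`, with respect to a field `ω` of symplectic forms in dimension `2n`. (For `k > 2n` there
are no nonzero `k`-forms.) -/
noncomputable def codiff (n : ℕ) (ω : E → AltForm E 2) {j : ℕ} (ξ : E → AltForm E (j + 1)) (x : E) :
    AltForm E j :=
  if h : j + 1 ≤ 2 * n then
    (-1 : ℝ) ^ (j + 1) •
      star n (show 2 * n - (j + 1) + 1 + j = 2 * n by omega) (ω x)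
        (extDeriv
          (fun y => star n (show j + 1 + (2 * n - (j + 1)) = 2 * n by omega) (ω y) (ξ y)) x)
  else 0

end AltForm

/-! ### Differential forms on open sets -/

open scoped ContDiff in
theorem two_le_infty : (2 : WithTop ℕ∞) ≤ ∞ := by
  have h : (2 : ℕ∞) ≤ ⊤ := le_top
  exact WithTop.coe_le_coe.2 h

section Pullback

variable {E E' : Type*} [NormedAddCommGroup E] [NormedSpace ℝ E]
  [NormedAddCommGroup E'] [NormedSpace ℝ E'] {k : ℕ}

/-- The pullback `f^*α` of a differential form. -/
noncomputable def formPullback (f : E → E') (α : E' → AltForm E' k) (x : E) : AltForm E k :=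
  (α (f x)).compContinuousLinearMap (fderiv ℝ f x)

open scoped ContDiff in
theorem extDeriv_formPullback {f : E → E'} {α : E' → AltForm E' k} {x : E}
    (hα : DifferentiableAt ℝ α (f x)) (hf : ContDiffAt ℝ ∞ f x) :
    extDeriv (formPullback f α) x = formPullback f (extDeriv α) x :=
  extDeriv_pullback hα hf (by
    rw [minSmoothness_of_isRCLikeNormedField]
    exact two_le_infty)

open scoped ContDiff in
theorem contDiffOn_extDeriv {α : E → AltForm E k} {V : Set E} (hV : IsOpen V)
    (hα : ContDiffOn ℝ ∞ α V) : ContDiffOn ℝ ∞ (extDeriv α) V :=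
  (ContinuousAlternatingMap.alternatizeUncurryFinCLM ℝ E ℝ).contDiff.comp_contDiffOn
    (hα.fderiv_of_isOpen hV (by simp))

end Pullback

/-! ### Orbifolds -/

universe u v w

/-- The Euclidean space `ℝ^m`. -/
abbrev Model (m : ℕ) : Type := EuclideanSpace ℝ (Fin m)

open scoped ContDiff in
/-- A uniformizing system `(V, G, π)` of dimension `m` over the open subset `U = π(V)` of `X`: an
open set `V ⊆ ℝ^m`, a finite group `G` acting smoothly and effectively on `V`, and a continuous map
`π : V → X` which induces a homeomorphism of `V / G` onto the open set `U`, that is, `π` is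
continuous and open and its fibres are the orbits of `G`. Only the restrictions to `V` of `act` and
of `proj` are relevant. -/
structure UniformizingSystem (m : ℕ) (X : Type v) [TopologicalSpace X] where
  V : Set (Model m)
  isOpen_V : IsOpen V
  G : Type u
  [group : Group G]
  [finite : Finite G]
  act : G → Model m → Model m
  act_mem : ∀ g, ∀ x ∈ V, act g x ∈ V
  act_one : ∀ x ∈ V, act 1 x = x
  act_mul : ∀ g h, ∀ x ∈ V, act (g * h) x = act g (act h x)
  act_smooth : ∀ g, ContDiffOn ℝ ∞ (act g) V
  act_effective : ∀ g, (∀ x ∈ V, act g x = x) → g = 1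
  proj : Model m → X
  continuousOn_proj : ContinuousOn proj V
  isOpen_image_proj : ∀ O ⊆ V, IsOpen O → IsOpen (proj '' O)
  proj_eq_iff : ∀ x ∈ V, ∀ y ∈ V, proj x = proj y ↔ ∃ g, act g x = y

namespace UniformizingSystem

variable {m : ℕ} {X : Type v} [TopologicalSpace X]

attribute [instance] UniformizingSystem.group UniformizingSystem.finite

/-- The open set `U` uniformized by `(V, G, π)`. -/
def U (W : UniformizingSystem.{u} m X) : Set X := W.proj '' W.V

open scoped ContDiff in
/-- An injection `(W, H, χ) → (V, G, π)` of uniformizing systems: an injective homomorphism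
`lam : H → G` and a `lam`-equivariant smooth open embedding `φ : W → V` with `π ∘ φ = χ`. The
embedding is given as a diffeomorphism of `W` onto an open subset of `V`. -/
structure Injection (A B : UniformizingSystem.{u} m X) where
  φ : OpenPartialHomeomorph (Model m) (Model m)
  source_eq : φ.source = A.V
  target_subset : φ.target ⊆ B.V
  smooth : ContDiffOn ℝ ∞ φ φ.source
  smooth_symm : ContDiffOn ℝ ∞ φ.symm φ.target
  lam : A.G →* B.G
  lam_injective : Function.Injective lam
  equivariant : ∀ g, ∀ x ∈ A.V, φ (A.act g x) = B.act (lam g) (φ x)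
  proj_comp : ∀ x ∈ A.V, B.proj (φ x) = A.proj x

end UniformizingSystem

/-- An orbifold structure of dimension `m` on the Hausdorff second countable space `X`: a family of
uniformizing systems whose sets `U` cover `X` and which are compatible: every point common to two of
the sets `U` has an open neighbourhood with a uniformizing system that admits injections into
both. -/
structure Orbifold (m : ℕ) (X : Type v) [TopologicalSpace X] [T2Space X]
    [SecondCountableTopology X] where
  ι : Type w
  chart : ι → UniformizingSystem.{u} m X
  covers : ∀ p : X, ∃ i, p ∈ (chart i).U
  compatible : ∀ i j, ∀ p ∈ (chart i).U ∩ (chart j).U, ∃ W : UniformizingSystem.{u} m X,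
    p ∈ W.U ∧ Nonempty (W.Injection (chart i)) ∧ Nonempty (W.Injection (chart j))

namespace Orbifold

variable {m : ℕ} {X : Type v} [TopologicalSpace X] [T2Space X] [SecondCountableTopology X]

open UniformizingSystem

open scoped ContDiff in
/-- The space `Ω^k(X)` of differential `k`-forms on an orbifold: families of smooth forms `s i` on
the sets `V i` of the charts which are invariant under the groups `G i` and which agree on overlaps,
that is, have the same pullback under injections of one uniformizing system into two charts.
(A form on `V i` is represented by its extension by zero to `ℝ^m`.) -/
def Form (𝒳 : Orbifold.{u, v, w} m X) (k : ℕ) : Submodule ℝ (𝒳.ι → Model m → AltForm (Model m) k) where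
  carrier := {s |
    (∀ i, ContDiffOn ℝ ∞ (s i) (𝒳.chart i).V) ∧
    (∀ i, ∀ x ∉ (𝒳.chart i).V, s i x = 0) ∧
    (∀ i g, ∀ x ∈ (𝒳.chart i).V, formPullback ((𝒳.chart i).act g) (s i) x = s i x) ∧
    (∀ i j (W : UniformizingSystem.{u} m X) (a : W.Injection (𝒳.chart i))
      (b : W.Injection (𝒳.chart j)), ∀ x ∈ W.V,
        formPullback a.φ (s i) x = formPullback b.φ (s j) x)}
  add_mem' := by
    rintro s t ⟨h1, h2, h3, h4⟩ ⟨k1, k2, k3, k4⟩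
    refine ⟨fun i => (h1 i).add (k1 i), fun i x hx => ?_, fun i g x hx => ?_,
      fun i j W a b x hx => ?_⟩
    · simp [h2 i x hx, k2 i x hx]
    · exact congrArg₂ (· + ·) (h3 i g x hx) (k3 i g x hx)
    · exact congrArg₂ (· + ·) (h4 i j W a b x hx) (k4 i j W a b x hx)
  zero_mem' := ⟨fun _ => contDiffOn_const, fun _ _ _ => rfl, fun _ _ _ _ => rfl,
    fun _ _ _ _ _ _ _ => rfl⟩
  smul_mem' := by
    rintro c s ⟨h1, h2, h3, h4⟩
    refine ⟨fun i => (h1 i).const_smul c, fun i x hx => ?_, fun i g x hx => ?_,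
      fun i j W a b x hx => ?_⟩
    · simp [h2 i x hx]
    · exact congrArg (c • ·) (h3 i g x hx)
    · exact congrArg (c • ·) (h4 i j W a b x hx)

variable (𝒳 : Orbifold.{u, v, w} m X)

theorem contDiffAt_form {𝒳 : Orbifold.{u, v, w} m X} {k : ℕ} (s : 𝒳.Form k) {i : 𝒳.ι}
    {x : Model m} (hx : x ∈ (𝒳.chart i).V) : ContDiffAt ℝ ((⊤ : ℕ∞) : WithTop ℕ∞) (s.1 i) x :=
  (s.2.1 i).contDiffAt ((𝒳.chart i).isOpen_V.mem_nhds hx)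

theorem differentiableAt_form {𝒳 : Orbifold.{u, v, w} m X} {k : ℕ} (s : 𝒳.Form k) {i : 𝒳.ι}
    {x : Model m} (hx : x ∈ (𝒳.chart i).V) : DifferentiableAt ℝ (s.1 i) x :=
  (contDiffAt_form s hx).differentiableAt (by simp)

open Classical in
/-- The exterior derivative `d : Ω^k(X) → Ω^{k+1}(X)`, computed in each chart. -/
noncomputable def d (k : ℕ) : 𝒳.Form k →ₗ[ℝ] 𝒳.Form (k + 1) where
  toFun s := ⟨fun i x => if x ∈ (𝒳.chart i).V then extDeriv (s.1 i) x else 0, by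
    have mem : ∀ i (W : UniformizingSystem.{u} m X) (a : W.Injection (𝒳.chart i)),
        ∀ x ∈ W.V, a.φ x ∈ (𝒳.chart i).V := fun i W a x hx =>
      a.target_subset (a.φ.map_source (a.source_eq ▸ hx))
    refine ⟨fun i => ?_, fun i x hx => if_neg hx, fun i g x hx => ?_, fun i j W a b x hx => ?_⟩
    · exact (contDiffOn_extDeriv (𝒳.chart i).isOpen_V (s.2.1 i)).congr fun x hx => if_pos hx
    · have hV := (𝒳.chart i).isOpen_V.mem_nhds hx
      have hg := (𝒳.chart i).act_mem g x hx
      simp only [formPullback, if_pos hg, if_pos hx]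
      change formPullback _ (extDeriv (s.1 i)) x = _
      rw [← extDeriv_formPullback (differentiableAt_form s hg)
        (((𝒳.chart i).act_smooth g).contDiffAt hV)]
      exact Filter.EventuallyEq.extDeriv_eq
        (Filter.eventually_of_mem hV fun y hy => s.2.2.2.1 i g y hy)
    · have hW := W.isOpen_V.mem_nhds hx
      have ha := mem i W a x hx
      have hb := mem j W b x hx
      simp only [formPullback, if_pos ha, if_pos hb]
      change formPullback _ (extDeriv (s.1 i)) x = formPullback _ (extDeriv (s.1 j)) x
      rw [← extDeriv_formPullback (differentiableAt_form s ha)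
          (a.smooth.contDiffAt (a.source_eq ▸ hW)),
        ← extDeriv_formPullback (differentiableAt_form s hb)
          (b.smooth.contDiffAt (b.source_eq ▸ hW))]
      exact Filter.EventuallyEq.extDeriv_eq
        (Filter.eventually_of_mem hW fun y hy => s.2.2.2.2 i j W a b y hy)⟩
  map_add' s t := by
    ext1
    funext i x
    by_cases hx : x ∈ (𝒳.chart i).V
    · simpa [hx] using extDeriv_add (differentiableAt_form s hx) (differentiableAt_form t hx)
    · simp [hx]
  map_smul' c s := by
    ext1
    funext i x
    by_cases hx : x ∈ (𝒳.chart i).V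
    · simpa [hx] using extDeriv_smul c (s.1 i)
    · simp [hx]

theorem d_apply {k : ℕ} (s : 𝒳.Form k) {i : 𝒳.ι} {x : Model m} (hx : x ∈ (𝒳.chart i).V) :
    (𝒳.d k s).1 i x = extDeriv (s.1 i) x := if_pos hx

theorem d_comp_d {k : ℕ} (s : 𝒳.Form k) : 𝒳.d (k + 1) (𝒳.d k s) = 0 := by
  ext1
  funext i x
  by_cases hx : x ∈ (𝒳.chart i).V
  · rw [d_apply 𝒳 _ hx]
    have : (𝒳.d k s).1 i =ᶠ[nhds x] extDeriv (s.1 i) :=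
      Filter.eventually_of_mem ((𝒳.chart i).isOpen_V.mem_nhds hx) fun y hy => d_apply 𝒳 s hy
    rw [this.extDeriv_eq, extDeriv_extDeriv_apply (contDiffAt_form s hx)]
    · rfl
    · rw [minSmoothness_of_isRCLikeNormedField]
      exact two_le_infty
  · exact (𝒳.d (k + 1) (𝒳.d k s)).2.2.1 i x hx

/-- Closed `k`-forms. -/
noncomputable def closedForms (k : ℕ) : Submodule ℝ (𝒳.Form k) := LinearMap.ker (𝒳.d k)

/-- Exact `k`-forms. -/
noncomputable def exactForms : (k : ℕ) → Submodule ℝ (𝒳.Form k)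
  | 0 => ⊥
  | k + 1 => LinearMap.range (𝒳.d k)

/-- The de Rham cohomology `H^k(X)` of the orbifold: closed forms modulo exact forms. -/
abbrev Cohomology (k : ℕ) : Type _ :=
  𝒳.closedForms k ⧸ (𝒳.exactForms k).submoduleOf (𝒳.closedForms k)

/-- The cohomology class of a closed form. -/
noncomputable def cohomologyClass (k : ℕ) : 𝒳.closedForms k →ₗ[ℝ] 𝒳.Cohomology k :=
  Submodule.mkQ _

/-- A symplectic structure on the orbifold: a closed nondegenerate `2`-form. -/
structure SymplecticForm where
  form : 𝒳.Form 2
  closed : 𝒳.d 2 form = 0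
  nondegenerate : ∀ i, ∀ x ∈ (𝒳.chart i).V, (form.1 i x).Nondegenerate

namespace SymplecticForm

variable {𝒳}

/-- The operator `ξ ↦ ω ∧ ξ` on forms. -/
noncomputable def wedge (ω : 𝒳.SymplecticForm) (k : ℕ) : 𝒳.Form k →ₗ[ℝ] 𝒳.Form (k + 2) where
  toFun s := ⟨fun i x => AltForm.wedge (Nat.add_comm 2 k) (ω.form.1 i x) (s.1 i x), by
    refine ⟨fun i => ?_, fun i x hx => ?_, fun i g x hx => ?_, fun i j W a b x hx => ?_⟩
    · exact (AltForm.wedgeL (Nat.add_comm 2 k)).isBoundedBilinearMap.contDiff.comp_contDiffOn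
        ((ω.form.2.1 i).prodMk (s.2.1 i))
    · change AltForm.wedgeL (Nat.add_comm 2 k) _ _ = 0
      rw [s.2.2.1 i x hx, map_zero]
    · rw [formPullback, AltForm.wedge_pullback]
      exact congrArg₂ _ (ω.form.2.2.2.1 i g x hx) (s.2.2.2.1 i g x hx)
    · rw [formPullback, formPullback, AltForm.wedge_pullback, AltForm.wedge_pullback]
      exact congrArg₂ _ (ω.form.2.2.2.2 i j W a b x hx) (s.2.2.2.2 i j W a b x hx)⟩
  map_add' s t := by
    ext1
    funext i x
    exact (AltForm.wedgeL (Nat.add_comm 2 k) (ω.form.1 i x)).map_add _ _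
  map_smul' c s := by
    ext1
    funext i x
    exact (AltForm.wedgeL (Nat.add_comm 2 k) (ω.form.1 i x)).map_smul _ _

theorem d_wedge (ω : 𝒳.SymplecticForm) {k : ℕ} (s : 𝒳.Form k) :
    𝒳.d (k + 2) (ω.wedge k s) = ω.wedge (k + 1) (𝒳.d k s) := by
  ext1
  funext i x
  by_cases hx : x ∈ (𝒳.chart i).V
  · have hc : extDeriv (ω.form.1 i) x = 0 := by
      rw [← d_apply 𝒳 ω.form hx, ω.closed]
      rfl
    rw [d_apply 𝒳 _ hx]
    change _ = AltForm.wedge _ (ω.form.1 i x) ((𝒳.d k s).1 i x)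
    rw [d_apply 𝒳 s hx]
    exact AltForm.extDeriv_wedge (differentiableAt_form ω.form hx) (differentiableAt_form s hx) hc _ _
  · rw [(𝒳.d (k + 2) (ω.wedge k s)).2.2.1 i x hx, (ω.wedge (k + 1) (𝒳.d k s)).2.2.1 i x hx]

theorem wedge_mem_closedForms (ω : 𝒳.SymplecticForm) {k : ℕ} (s : 𝒳.Form k)
    (hs : s ∈ 𝒳.closedForms k) : ω.wedge k s ∈ 𝒳.closedForms (k + 2) := by
  have h : 𝒳.d k s = 0 := hs
  change 𝒳.d (k + 2) (ω.wedge k s) = 0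
  rw [d_wedge, h, map_zero]

theorem wedge_mem_exactForms (ω : 𝒳.SymplecticForm) {k : ℕ} (s : 𝒳.Form k)
    (hs : s ∈ 𝒳.exactForms k) : ω.wedge k s ∈ 𝒳.exactForms (k + 2) := by
  cases k with
  | zero =>
    have h : s = 0 := hs
    rw [h, map_zero]
    exact zero_mem _
  | succ k =>
    obtain ⟨t, rfl⟩ : ∃ t, 𝒳.d k t = s := hs
    exact ⟨ω.wedge k t, d_wedge ω t⟩

/-- The Lefschetz map `L : H^k(X) → H^{k+2}(X)`, `L[ξ] = [ω ∧ ξ]`. -/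
noncomputable def L (ω : 𝒳.SymplecticForm) (k : ℕ) : 𝒳.Cohomology k →ₗ[ℝ] 𝒳.Cohomology (k + 2) :=
  Submodule.mapQ _ _ ((ω.wedge k).restrict fun s hs => ω.wedge_mem_closedForms s hs)
    fun s hs => ω.wedge_mem_exactForms s.1 hs

/-- The iterate `L^k : H^p(X) → H^{p+2k}(X)`. -/
noncomputable def Lpow (ω : 𝒳.SymplecticForm) (p : ℕ) :
    (k : ℕ) → 𝒳.Cohomology p →ₗ[ℝ] 𝒳.Cohomology (p + 2 * k)
  | 0 => LinearMap.id
  | k + 1 => ω.L (p + 2 * k) ∘ₗ Lpow ω p k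

end SymplecticForm

/-- A form `ξ` on an orbifold of dimension `2n` with `δξ = 0`; on `0`-forms `δ` is zero. -/
def SymplecticForm.IsCoclosed {n : ℕ} {𝒳 : Orbifold.{u, v, w} (2 * n) X} (ω : 𝒳.SymplecticForm) :
    {k : ℕ} → 𝒳.Form k → Prop
  | 0, _ => True
  | _ + 1, ξ => ∀ i, ∀ x ∈ (𝒳.chart i).V, AltForm.codiff n (ω.form.1 i) (ξ.1 i) x = 0

/-- Symplectically harmonic forms: `dξ = 0` and `δξ = 0`. -/
def SymplecticForm.IsHarmonic {n : ℕ} {𝒳 : Orbifold.{u, v, w} (2 * n) X} (ω : 𝒳.SymplecticForm)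
    {k : ℕ} (ξ : 𝒳.Form k) : Prop :=
  𝒳.d k ξ = 0 ∧ ω.IsCoclosed ξ

end Orbifold

/-! The forms on `X`, taken in all degrees together, are a module over `sl₂`: `L` is `ω ∧ ·`, `Λ` is
contraction with the dual bivector, and `H` is multiplication by `k - n` in degree `k`. Forms vanish
above degree `2n`, so the weights are bounded. This replaces finite dimensionality: on vectors of
weight `-k` the map `L^k` is injective (`eq_zero_of_pow_apply`), and it reaches every vector of
weight `k` (`exists_pow_apply`), although spaces of forms have infinite dimension.

The derivative `d` has weight one and commutes with `L`, since `ω` is closed. Under the adjoint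
action it is a highest weight vector of weight one, so it generates a two-dimensional representation
and `[Λ, [Λ, d]] = 0` (`Λ_bracket`). Hence the vectors with `d x = 0` and `d Λ x = 0` form an
`sl₂`-submodule. If they represent all classes, surjectivity of `L^k` on this submodule gives
surjectivity on cohomology. Conversely, a closed `x` of weight `-k` is corrected by some `L y` and
an exact term until `L^(k+1)` kills it; it is then killed by `Λ`, hence harmonic, and descending
induction on `k` treats `y` (`harmonic_iff_surjective`). The argument is algebraic and sees `X` only
through `d`, `L` and `Λ`.

It remains to identify `δ ξ = 0` with `d Λ ξ = 0` for closed `ξ` (`isHarmonic_iff`). On `p`-forms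
the star operator is, up to sign, the component of degree `2n - p` of `e^L e^Λ` (`star_eq`), because
`e^L e^Λ` turns exterior multiplication by `ω(v, ·)` into `ι_v`. Conjugating `d` by `e^L e^Λ` gives
`d + [d, Λ]`, so `d ⋆ ξ = ± ⋆ d Λ ξ` (`extDeriv_star`), and the star operator is injective. -/

/-! ### Representations of `sl₂` with bounded weights -/

/-- Operators `L`, `Λ`, `H` on a real vector space which satisfy the relations of `sl₂`, where `H` is
diagonalizable with integral eigenvalues of absolute value at most `n`. -/
structure LefschetzTriple {M : Type*} [AddCommGroup M] [Module ℝ M] (n : ℕ)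
    (L Λ H : Module.End ℝ M) : Prop where
  H_mul_L : H * L = L * H + (L + L)
  H_mul_Λ : H * Λ = Λ * H - (Λ + Λ)
  Λ_mul_L : Λ * L = L * Λ + H
  eq_zero_of_lt : ∀ r : ℤ, n < |r| → ∀ x, H x = (r : ℝ) • x → x = 0
  eq_top : ∀ S : Submodule ℝ M, (∀ (r : ℤ) (x : M), H x = (r : ℝ) • x → x ∈ S) → S = ⊤

namespace LefschetzTriple

variable {M : Type*} [AddCommGroup M] [Module ℝ M] {n : ℕ} {L Λ H d : Module.End ℝ M}

/-- The symmetry of `sl₂` exchanging raising and lowering operators; each result on `L` thereby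
yields one on `Λ`. -/
theorem swap (T : LefschetzTriple n L Λ H) : LefschetzTriple n Λ L (-H) where
  H_mul_L := by rw [neg_mul, T.H_mul_Λ]; simp; abel
  H_mul_Λ := by rw [neg_mul, T.H_mul_L]; simp; abel
  Λ_mul_L := by rw [T.Λ_mul_L]; abel
  eq_zero_of_lt r hr x hx := T.eq_zero_of_lt (-r) (by simpa using hr) x (by
    rw [LinearMap.neg_apply, neg_eq_iff_eq_neg] at hx
    simp [hx])
  eq_top S hS := T.eq_top S fun r x hx => hS (-r) x (by simp [hx])

section Basic

variable (T : LefschetzTriple n L Λ H)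
include T

theorem H_L (x : M) : H (L x) = L (H x) + (L x + L x) := LinearMap.congr_fun T.H_mul_L x

theorem H_Λ (x : M) : H (Λ x) = Λ (H x) - (Λ x + Λ x) := LinearMap.congr_fun T.H_mul_Λ x

theorem Λ_L (x : M) : Λ (L x) = L (Λ x) + H x := LinearMap.congr_fun T.Λ_mul_L x

theorem weight_L {r : ℤ} {x : M} (hx : H x = (r : ℝ) • x) : H (L x) = ((r + 2 : ℤ) : ℝ) • L x := by
  rw [T.H_L, hx, map_smul]; push_cast; module

theorem weight_Λ {r : ℤ} {x : M} (hx : H x = (r : ℝ) • x) : H (Λ x) = ((r - 2 : ℤ) : ℝ) • Λ x := by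
  rw [T.H_Λ, hx, map_smul]; push_cast; module

theorem weight_L_pow {r : ℤ} {x : M} (hx : H x = (r : ℝ) • x) (j : ℕ) :
    H ((L ^ j) x) = ((r + 2 * j : ℤ) : ℝ) • (L ^ j) x := by
  induction j with
  | zero => simpa using hx
  | succ j ih =>
    rw [pow_succ', Module.End.mul_apply, T.weight_L ih]
    congr 2; push_cast; ring

/-- `Λ L^{j+1} x = L^{j+1} Λ x + (j+1)(r+j) L^j x` for `x` of weight `r`. -/
theorem Λ_L_pow {r : ℤ} {x : M} (hx : H x = (r : ℝ) • x) (j : ℕ) :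
    Λ ((L ^ (j + 1)) x) = (L ^ (j + 1)) (Λ x) + ((j + 1) * (r + j) : ℝ) • (L ^ j) x := by
  induction j with
  | zero => simp [T.Λ_L, hx]
  | succ j ih =>
    rw [pow_succ' L (j + 1), Module.End.mul_apply, T.Λ_L, ih, T.weight_L_pow hx, map_add, map_smul,
      ← Module.End.mul_apply, ← Module.End.mul_apply L (L ^ j), ← pow_succ', ← pow_succ',
      add_assoc]
    rw [← Module.End.mul_apply]
    congr 1
    push_cast
    module

/-- Each `L` raises the weight by two, and the weights lie in an interval of length `2n`. -/
theorem pow_eq_zero : L ^ (n + 1) = 0 := by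
  rw [← LinearMap.ker_eq_top]
  refine T.eq_top _ fun r x hx => ?_
  by_cases h : n < |r|
  · rw [T.eq_zero_of_lt r h x hx]; exact zero_mem _
  · refine T.eq_zero_of_lt _ ?_ _ (T.weight_L_pow hx (n + 1))
    rw [not_lt, abs_le] at h
    rw [lt_abs]; left; push_cast; linarith

/-- Injectivity of `L^j` on vectors of weight `-k`, `j ≤ k`. -/
theorem eq_zero_of_pow_apply {k j : ℕ} (hj : j ≤ k) {x : M} (hx : H x = ((-k : ℤ) : ℝ) • x)
    (h : (L ^ j) x = 0) : x = 0 := by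
  -- The number `m` bounds how far `k` is below the range `k > n`, where there are no nonzero
  -- vectors; induction on `m` is descending induction on `k`.
  obtain ⟨m, hm⟩ : ∃ m, n < k + m := ⟨n + 1, by omega⟩
  induction m using Nat.strong_induction_on generalizing k j x with
  | _ m ihm =>
  by_cases hk : n < k
  · exact T.eq_zero_of_lt _ (by rw [abs_neg, Nat.abs_cast]; exact_mod_cast hk) x hx
  induction j generalizing x with
  | zero => simpa using h
  | succ j ih =>
    have h1 := T.Λ_L_pow hx j
    rw [h, map_zero] at h1
    set c : ℝ := (j + 1) * (((-k : ℤ) : ℝ) + j) with hc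
    have hc0 : c ≠ 0 := by
      have : (j : ℝ) + 1 ≤ k := by exact_mod_cast hj
      refine mul_ne_zero (by positivity) (ne_of_lt ?_)
      push_cast
      linarith
    have hy := T.weight_Λ hx
    have hw : H (L (Λ x)) = ((-k : ℤ) : ℝ) • L (Λ x) := by
      rw [T.weight_L hy]; congr 2; ring
    -- The formula for `Λ L^(j+1) x = 0` says that `L^j` kills this vector, which again has weight
    -- `-k`.
    have hu : L (Λ x) + c • x = 0 := by
      refine ih (by omega) ?_ ?_
      · rw [map_add, map_smul, hw, hx, smul_add, smul_comm]
      · rw [map_add, map_smul, h1, ← Module.End.mul_apply (L ^ j) L, ← pow_succ]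
    -- Since `L Λ x = -c x`, the vector `L^(j+2) Λ x` is a multiple of `L^(j+1) x = 0`, and `Λ x`
    -- has weight `-(k+2)`.
    have hΛ : Λ x = 0 := by
      refine ihm (m - 1) (by omega) (k := k + 2) (j := j + 2) (by omega) ?_ ?_ (by omega)
      · rw [hy]; congr 2; push_cast; ring
      · rw [pow_succ, Module.End.mul_apply, eq_neg_of_add_eq_zero_left hu, map_neg, map_smul, h,
          smul_zero, neg_zero]
    rw [hΛ, map_zero, zero_add] at hu
    exact (smul_eq_zero.1 hu).resolve_left hc0

/-- Vectors of weight `-k` killed by `L^{k+1}` are killed by `Λ`. -/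
theorem Λ_eq_zero {k : ℕ} {x : M} (hx : H x = ((-k : ℤ) : ℝ) • x) (h : (L ^ (k + 1)) x = 0) :
    Λ x = 0 := by
  refine T.eq_zero_of_pow_apply (k := k + 2) (j := k + 2) le_rfl
    (by rw [T.weight_Λ hx]; congr 2; push_cast; ring) ?_
  -- Both `L^(k+2) x` and `L^(k+1) x` vanish here, which leaves `L^(k+2) Λ x = 0`, where `L^(k+2)`
  -- is injective.
  have h1 := T.Λ_L_pow hx (k + 1)
  rw [h, pow_succ' L (k + 1), Module.End.mul_apply, h, smul_zero, add_zero, map_zero, map_zero] at h1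
  rw [h1, ← pow_succ']

/-- For `x` of weight `k` killed by `L` the vector `L^j Λ^j x` is a nonzero multiple of `x` if
`j ≤ k`. -/
theorem L_pow_Λ_pow {k : ℕ} {x : M} (hx : H x = ((k : ℤ) : ℝ) • x) (h : L x = 0) {j : ℕ}
    (hj : j ≤ k) : ∃ c : ℝ, c ≠ 0 ∧ (L ^ j) ((Λ ^ j) x) = c • x := by
  induction j with
  | zero => exact ⟨1, one_ne_zero, by simp⟩
  | succ j ih =>
    obtain ⟨c, hc, e⟩ := ih (by omega)
    have h1 := T.swap.Λ_L_pow (r := -k) (x := x) (by simp [hx]) j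
    rw [h, map_zero, zero_add] at h1
    refine ⟨((j + 1) * (((-k : ℤ) : ℝ) + j)) * c, mul_ne_zero ?_ hc, ?_⟩
    · have : (j : ℝ) + 1 ≤ k := by exact_mod_cast hj
      refine mul_ne_zero (by positivity) (ne_of_lt ?_)
      push_cast
      linarith
    · rw [pow_succ L, Module.End.mul_apply, h1, map_smul, e, smul_smul]

omit T in
theorem pow_mem {S : Submodule ℝ M} (hL : ∀ x ∈ S, L x ∈ S) {x : M} (hx : x ∈ S) (j : ℕ) :
    (L ^ j) x ∈ S := by
  induction j with
  | zero => simpa using hx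
  | succ j ih => rw [pow_succ', Module.End.mul_apply]; exact hL _ ih

/-- Surjectivity of `L^k` from weight `-k` to weight `k`, in a submodule stable under `L` and `Λ`. -/
theorem exists_pow_apply {S : Submodule ℝ M} (hL : ∀ x ∈ S, L x ∈ S) (hΛ : ∀ x ∈ S, Λ x ∈ S) {k : ℕ}
    {x : M} (hx : H x = ((k : ℤ) : ℝ) • x) (hS : x ∈ S) :
    ∃ y ∈ S, H y = ((-k : ℤ) : ℝ) • y ∧ (L ^ k) y = x := by
  obtain ⟨m, hm⟩ : ∃ m, n < k + m := ⟨n + 1, by omega⟩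
  induction m using Nat.strong_induction_on generalizing k x with
  | _ m ihm =>
  by_cases hk : n < k
  · obtain rfl := T.eq_zero_of_lt _ (by rw [Nat.abs_cast]; exact_mod_cast hk) x hx
    exact ⟨0, zero_mem _, by simp, by simp⟩
  -- Descending induction on `k` writes `L x = L^(k+2) z`, so `x - L^k (L z)` is killed by `L`.
  obtain ⟨z, hz, wz, ez⟩ := ihm (m - 1) (by omega) (k := k + 2) (x := L x)
    (by rw [T.weight_L hx]; push_cast; rfl) (hL x hS) (by omega)
  have wLz : H (L z) = ((-k : ℤ) : ℝ) • L z := by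
    rw [T.weight_L wz]; congr 2; push_cast; ring
  have wx' : H (x - (L ^ k) (L z)) = ((k : ℤ) : ℝ) • (x - (L ^ k) (L z)) := by
    rw [map_sub, hx, T.weight_L_pow wLz, smul_sub]; congr 3; ring
  have kx' : L (x - (L ^ k) (L z)) = 0 := by
    rw [map_sub, ← ez, ← Module.End.mul_apply (L ^ k), ← pow_succ, ← Module.End.mul_apply L,
      ← pow_succ', sub_self]
  obtain ⟨c, hc, e⟩ := T.L_pow_Λ_pow wx' kx' le_rfl
  -- The part of `x` killed by `L` is recovered from its image under `Λ^k`, because `L^k Λ^k` acts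
  -- on it as the nonzero scalar `c`.
  refine ⟨L z + c⁻¹ • (Λ ^ k) (x - (L ^ k) (L z)), ?_, ?_, ?_⟩
  · exact add_mem (hL _ hz) (S.smul_mem _ (pow_mem hΛ (sub_mem hS (pow_mem hL (hL _ hz) k)) k))
  · have := T.swap.weight_L_pow (r := -k) (x := x - (L ^ k) (L z))
      (by rw [LinearMap.neg_apply, wx']; simp) k
    rw [LinearMap.neg_apply, neg_eq_iff_eq_neg] at this
    rw [map_add, map_smul, wLz, this, smul_add, smul_comm, ← neg_smul]
    congr 3
    push_cast
    ring
  · rw [map_add, map_smul, e, smul_smul, inv_mul_cancel₀ hc, one_smul]; abel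

end Basic

/-! ### Operators of weight one which commute with `L` -/

/-- `[Λ, [Λ, d]] = 0` if `d` is of weight one and commutes with `L`. -/
theorem Λ_bracket (T : LefschetzTriple n L Λ H) (hd : H * d = d * H + d) (hL : d * L = L * d) :
    Λ * (d * Λ - Λ * d) = (d * Λ - Λ * d) * Λ := by
  set D := d * Λ - Λ * d with hD
  -- By the Jacobi identity `[D, L] = [d, [Λ, L]] = [d, H] = -d`.
  have hDL : D * L = L * D - d := by
    have : D * L = d * (Λ * L) - Λ * (d * L) := by rw [hD]; noncomm_ring
    rw [this, hL, T.Λ_mul_L, ← mul_assoc, T.Λ_mul_L, add_mul, mul_add, ← mul_assoc, hL, hd, hD]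
    noncomm_ring
  have hHD : H * D = D * H - D := by
    have : H * D = (H * d) * Λ - (H * Λ) * d := by rw [hD]; noncomm_ring
    rw [this, hd, T.H_mul_Λ, add_mul, mul_assoc d H, T.H_mul_Λ, sub_mul, mul_assoc Λ H, hd, hD]
    noncomm_ring
  have hDd : Λ * d = d * Λ - D := by rw [hD]; abel
  clear_value D
  -- The operator `y` commutes with `L` and has weight `-3`. A highest weight vector cannot have
  -- negative weight when the weights are bounded; the rest of the proof makes this argument on the
  -- module itself.
  set y := Λ * D - D * Λ with hy
  have hyL : y * L = L * y := by
    have : y * L = Λ * (D * L) - D * (Λ * L) := by rw [hy]; noncomm_ring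
    rw [hy] at this ⊢
    rw [this, hDL, T.Λ_mul_L, mul_sub, ← mul_assoc, T.Λ_mul_L, add_mul, mul_add, ← mul_assoc, hDL,
      hHD, mul_sub, hDd]
    noncomm_ring
  have hHy : H * y = y * H - (y + y + y) := by
    have : H * y = (H * Λ) * D - (H * D) * Λ := by rw [hy]; noncomm_ring
    rw [this, hHD, T.H_mul_Λ, sub_mul, mul_assoc Λ H, hHD, sub_mul, mul_assoc _ H, T.H_mul_Λ, hy]
    noncomm_ring
  have hyLj : ∀ j x, y ((L ^ j) x) = (L ^ j) (y x) := fun j x => by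
    have : Commute y (L ^ j) := Commute.pow_right hyL j
    exact LinearMap.congr_fun this.eq x
  have wy : ∀ (r : ℤ) x, H x = (r : ℝ) • x → H (y x) = ((r - 3 : ℤ) : ℝ) • y x := fun r x hx => by
    have := LinearMap.congr_fun hHy x
    simp only [Module.End.mul_apply, LinearMap.sub_apply, LinearMap.add_apply, hx, map_smul] at this
    rw [this]; push_cast; module
  have neg : ∀ (m k : ℕ), n < k + m → ∀ x, H x = ((-k : ℤ) : ℝ) • x → y x = 0 := by
    intro m
    induction m using Nat.strong_induction_on with
    | _ m ihm =>
    intro k hm x hx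
    by_cases hk : n < k
    · rw [T.eq_zero_of_lt _ (by rw [abs_neg, Nat.abs_cast]; exact_mod_cast hk) x hx, map_zero]
    have hLx := T.weight_L_pow hx (k + 1)
    -- The vector `L^(k+1) x` has weight `k + 2`, so it also comes from weight `-(k+2)`, where `y`
    -- vanishes by induction.
    obtain ⟨z, -, wz, ez⟩ := T.exists_pow_apply (S := ⊤) (fun _ _ => trivial) (fun _ _ => trivial)
      (k := k + 2) (x := (L ^ (k + 1)) x) (by rw [hLx]; congr 2; push_cast; ring) trivial
    have hz : y z = 0 := ihm (m - 1) (by omega) (k + 2) (by omega) z wz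
    -- Since `y x` has weight `-(k+3)`, the power `L^(k+1)` is injective on it.
    refine T.eq_zero_of_pow_apply (k := k + 3) (j := k + 1) (by omega)
      (by rw [wy _ x hx]; congr 2; push_cast; ring) ?_
    rw [← hyLj, ← ez, hyLj, hz, map_zero]
  rw [← sub_eq_zero]
  change y = 0
  rw [← LinearMap.ker_eq_top]
  refine T.eq_top _ fun r x hx => ?_
  rw [LinearMap.mem_ker]
  obtain ⟨k, rfl | rfl⟩ := r.eq_nat_or_neg
  · obtain ⟨z, -, wz, rfl⟩ := T.exists_pow_apply (S := ⊤) (fun _ _ => trivial) (fun _ _ => trivial)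
      hx trivial
    rw [hyLj, neg (n + 1) k (by omega) z wz, map_zero]
  · exact neg (n + 1) k (by omega) x hx

end LefschetzTriple

/-! ### Harmonic vectors and the Lefschetz property -/

namespace LefschetzTriple

variable {M : Type*} [AddCommGroup M] [Module ℝ M] {n : ℕ} {L Λ H d : Module.End ℝ M}

/-- The vectors `x` with `d x = 0` and `d Λ x = 0`. -/
def harmonic (Λ d : Module.End ℝ M) : Submodule ℝ M := LinearMap.ker d ⊓ LinearMap.ker (d * Λ)

theorem mem_harmonic {x : M} : x ∈ harmonic Λ d ↔ d x = 0 ∧ d (Λ x) = 0 := Iff.rfl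

/-- From `Λ L = L Λ + H`: both `d L Λ x = L d Λ x` and `d H x = H d x - d x` vanish. -/
theorem L_mem_harmonic (T : LefschetzTriple n L Λ H) (hd : H * d = d * H + d) (hL : d * L = L * d)
    (x : M) (hx : x ∈ harmonic Λ d) : L x ∈ harmonic Λ d := by
  obtain ⟨h1, h2⟩ := mem_harmonic.1 hx
  have hL' : ∀ x, d (L x) = L (d x) := LinearMap.congr_fun hL
  have hd' : H (d x) = d (H x) + d x := LinearMap.congr_fun hd x
  rw [h1, map_zero, add_zero] at hd'
  refine mem_harmonic.2 ⟨by rw [hL', h1, map_zero], ?_⟩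
  rw [T.Λ_L, map_add, hL', h2, ← hd', map_zero, add_zero]

/-- Evaluating `[Λ, [Λ, d]] = 0` at a harmonic `x` leaves only the term `d Λ Λ x`. -/
theorem Λ_mem_harmonic (T : LefschetzTriple n L Λ H) (hd : H * d = d * H + d) (hL : d * L = L * d)
    (x : M) (hx : x ∈ harmonic Λ d) : Λ x ∈ harmonic Λ d := by
  obtain ⟨h1, h2⟩ := mem_harmonic.1 hx
  have := LinearMap.congr_fun (T.Λ_bracket hd hL) x
  simp only [Module.End.mul_apply, LinearMap.sub_apply, h1, h2, map_zero, sub_zero] at this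
  exact mem_harmonic.2 ⟨h2, this.symm⟩

/-- Every class contains a harmonic vector if and only if the maps `L^k` from the classes of weight
`-k` to the classes of weight `k` are surjective. -/
theorem harmonic_iff_surjective (T : LefschetzTriple n L Λ H) (hd : H * d = d * H + d)
    (hL : d * L = L * d) (hdd : d * d = 0) :
    (∀ (r : ℤ) (x : M), H x = (r : ℝ) • x → d x = 0 →
        ∃ h z, H h = (r : ℝ) • h ∧ H z = ((r - 1 : ℤ) : ℝ) • z ∧ h ∈ harmonic Λ d ∧ x = h + d z) ↔
      ∀ (k : ℕ) (x : M), H x = ((k : ℤ) : ℝ) • x → d x = 0 →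
        ∃ y z, H y = ((-k : ℤ) : ℝ) • y ∧ H z = ((k - 1 : ℤ) : ℝ) • z ∧ d y = 0 ∧
          x = (L ^ k) y + d z := by
  have hLj : ∀ j x, d ((L ^ j) x) = (L ^ j) (d x) := fun j x => by
    have : Commute d (L ^ j) := Commute.pow_right hL j
    exact LinearMap.congr_fun this.eq x
  have hL' : ∀ x, d (L x) = L (d x) := LinearMap.congr_fun hL
  have hdd' : ∀ x, d (d x) = 0 := LinearMap.congr_fun hdd
  have wd : ∀ (r : ℤ) x, H x = (r : ℝ) • x → H (d x) = ((r + 1 : ℤ) : ℝ) • d x := fun r x hx => by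
    have := LinearMap.congr_fun hd x
    simp only [Module.End.mul_apply, LinearMap.add_apply, hx, map_smul] at this
    rw [this]; push_cast; module
  constructor
  · intro h1 k x hx hdx
    obtain ⟨h, z, wh, wz, hh, rfl⟩ := h1 k x hx hdx
    -- The preimage under `L^k` can be taken harmonic, hence closed, because the harmonic vectors
    -- form an `sl₂`-submodule.
    obtain ⟨y, hy, wy, rfl⟩ := T.exists_pow_apply (T.L_mem_harmonic hd hL)
      (T.Λ_mem_harmonic hd hL) wh hh
    exact ⟨y, z, wy, wz, hy.1, rfl⟩
  · intro h2
    -- Nonpositive weights come first, by descending induction on `k`. Nonnegative weights follow by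
    -- applying `L^k`, which preserves harmonic and exact vectors.
    have neg : ∀ (m k : ℕ), n < k + m → ∀ x, H x = ((-k : ℤ) : ℝ) • x → d x = 0 →
        ∃ h z, H h = ((-k : ℤ) : ℝ) • h ∧ H z = ((-k - 1 : ℤ) : ℝ) • z ∧ h ∈ harmonic Λ d ∧
          x = h + d z := by
      intro m
      induction m using Nat.strong_induction_on with
      | _ m ihm =>
      intro k hm x hx hdx
      by_cases hk : n < k
      · rw [T.eq_zero_of_lt _ (by rw [abs_neg, Nat.abs_cast]; exact_mod_cast hk) x hx]
        exact ⟨0, 0, by simp, by simp, zero_mem _, by simp⟩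
      have hLx := T.weight_L_pow hx (k + 1)
      obtain ⟨y, z, wy, wz, hdy, e⟩ := h2 (k + 2) ((L ^ (k + 1)) x)
        (by rw [hLx]; congr 2; push_cast; ring) (by rw [hLj, hdx, map_zero])
      obtain ⟨h, t, wh, wt, hh, rfl⟩ := ihm (m - 1) (by omega) (k + 2) (by omega) y wy hdy
      -- No closedness is needed to lift the primitive `z` of weight `k + 1` through `L^(k+1)`; the
      -- exact term becomes `L^(k+1) d θ`.
      obtain ⟨θ, -, wθ, rfl⟩ := T.exists_pow_apply (S := ⊤) (fun _ _ => trivial)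
        (fun _ _ => trivial) (k := k + 1) (x := z) (by rw [wz]; congr 2; push_cast; ring) trivial
      -- With `y = h + d t`, both corrections are chosen so that `L^(k+1) v = 0`. Then `Λ v = 0`,
      -- and the closed vector `v` is harmonic.
      set v := x - L (h + d t) - d θ with hv
      have wv : H v = ((-k : ℤ) : ℝ) • v := by
        rw [hv, map_sub, map_sub, hx, T.weight_L wy, wd _ _ wθ, smul_sub, smul_sub]
        congr 4 <;> push_cast <;> ring
      have Lv : (L ^ (k + 1)) v = 0 := by
        rw [hv, map_sub, map_sub, e, ← Module.End.mul_apply (L ^ (k + 1)) L, ← pow_succ, hLj]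
        abel
      have hdv : d v = 0 := by
        rw [hv, map_sub, map_sub, hdx, hL', hdy, hdd', map_zero, sub_zero, sub_zero]
      refine ⟨v + L h, L t + θ, ?_, ?_, add_mem (mem_harmonic.2 ⟨hdv, ?_⟩)
        (T.L_mem_harmonic hd hL h hh), ?_⟩
      · rw [map_add, wv, T.weight_L wh, smul_add]
        congr 3; push_cast; ring
      · rw [map_add, T.weight_L wt, wθ, smul_add]
        congr 3 <;> (push_cast; ring)
      · rw [T.Λ_eq_zero wv Lv, map_zero]
      · rw [hv, map_add, map_add, hL']
        abel
    intro r x hx hdx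
    obtain ⟨k, rfl | rfl⟩ := r.eq_nat_or_neg
    · obtain ⟨y, z, wy, wz, hdy, rfl⟩ := h2 k x hx hdx
      obtain ⟨h, t, wh, wt, hh, rfl⟩ := neg (n + 1) k (by omega) y wy hdy
      refine ⟨(L ^ k) h, (L ^ k) t + z, ?_, ?_, pow_mem (T.L_mem_harmonic hd hL) hh k, ?_⟩
      · rw [T.weight_L_pow wh]; congr 2; ring
      · rw [map_add, T.weight_L_pow wt, wz, smul_add]
        congr 3; ring
      · rw [map_add, map_add, hLj]
        abel
    · exact neg (n + 1) k (by omega) x hx hdx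

end LefschetzTriple

/-! ### Exponentials of nilpotent operators -/

section TruncExp

variable {M M' : Type*} [AddCommGroup M] [Module ℝ M] [AddCommGroup M'] [Module ℝ M']

/-- The truncated exponential `∑_{j ≤ N} a^j / j!`. -/
noncomputable def truncExp (N : ℕ) (a : Module.End ℝ M) : Module.End ℝ M :=
  ∑ j ∈ Finset.range (N + 1), (j.factorial : ℝ)⁻¹ • a ^ j

theorem truncExp_apply (N : ℕ) (a : Module.End ℝ M) (x : M) :
    truncExp N a x = ∑ j ∈ Finset.range (N + 1), (j.factorial : ℝ)⁻¹ • (a ^ j) x := by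
  simp [truncExp]

/-- `D e^a = e^a (D + B)` if `[D, a] = B` commutes with `a` and `a` is nilpotent. -/
theorem mul_truncExp {N : ℕ} {a B D : Module.End ℝ M} (ha : a ^ N = 0) (hD : D * a = a * D + B)
    (hB : B * a = a * B) : D * truncExp N a = truncExp N a * (D + B) := by
  have hB' : ∀ j, B * a ^ j = a ^ j * B := fun j => (Commute.pow_right hB j).eq
  -- The commutator with `a` is a derivation, and `B` commutes with `a`.
  have key : ∀ j : ℕ, D * a ^ (j + 1) = a ^ (j + 1) * D + ((j + 1 : ℕ) : ℝ) • (a ^ j * B) := by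
    intro j
    induction j with
    | zero => simp [hD]
    | succ j ih =>
      rw [pow_succ a (j + 1), ← mul_assoc, ih, add_mul, mul_assoc _ D, hD, smul_mul_assoc,
        mul_assoc _ B, hB]
      simp only [pow_succ, mul_add, mul_assoc]
      push_cast
      module
  -- As `a ^ N = 0`, the last term is absent, so the sum that loses one power of `a` in the
  -- commutator is again the full exponential.
  have h1 : truncExp N a = ∑ j ∈ Finset.range N, (j.factorial : ℝ)⁻¹ • a ^ j := by
    rw [truncExp, Finset.sum_range_succ, ha, smul_zero, add_zero]
  have h2 : D * truncExp N a = truncExp N a * D +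
      (∑ j ∈ Finset.range N, (j.factorial : ℝ)⁻¹ • a ^ j) * B := by
    rw [truncExp, Finset.sum_range_succ', mul_add, add_mul, Finset.mul_sum, Finset.sum_mul,
      Finset.sum_mul]
    simp only [mul_smul_comm, smul_mul_assoc, key, pow_zero, mul_one, one_mul, smul_add,
      Finset.sum_add_distrib]
    have : ∀ j : ℕ, ((j + 1).factorial : ℝ)⁻¹ • ((j + 1 : ℕ) : ℝ) • (a ^ j * B) =
        (j.factorial : ℝ)⁻¹ • (a ^ j * B) := fun j => by
      rw [smul_smul, Nat.factorial_succ]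
      congr 1
      push_cast
      field_simp
    simp only [this]
    abel
  rw [h2, ← h1, mul_add]

/-- Passes exponentials of operators on orbifold forms to values at a point. -/
theorem map_truncExp {N : ℕ} {a : Module.End ℝ M} {b : Module.End ℝ M'} (f : M →ₗ[ℝ] M')
    (h : ∀ x, f (a x) = b (f x)) (x : M) : f (truncExp N a x) = truncExp N b (f x) := by
  have hj : ∀ j x, f ((a ^ j) x) = (b ^ j) (f x) := fun j => by
    induction j with
    | zero => simp
    | succ j ih => intro x; rw [pow_succ', Module.End.mul_apply, h, ih, pow_succ', Module.End.mul_apply]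
  simp [truncExp_apply, map_sum, hj]

end TruncExp

/-! ### Operators on graded spaces -/

namespace Graded

variable {F : ℕ → Type*} [∀ k, AddCommGroup (F k)] [∀ k, Module ℝ (F k)]

/-- The operator of degree one with given components. -/
def raise (f : ∀ k, F k →ₗ[ℝ] F (k + 1)) : Module.End ℝ (∀ k, F k) :=
  LinearMap.pi fun
    | 0 => 0
    | k + 1 => f k ∘ₗ LinearMap.proj k

/-- The operator of degree two with given components. -/
def raiseTwo (f : ∀ k, F k →ₗ[ℝ] F (k + 2)) : Module.End ℝ (∀ k, F k) :=
  LinearMap.pi fun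
    | 0 => 0
    | 1 => 0
    | k + 2 => f k ∘ₗ LinearMap.proj k

/-- The operator of degree `-m` with given components. -/
def lower (m : ℕ) (f : ∀ k, F (k + m) →ₗ[ℝ] F k) : Module.End ℝ (∀ k, F k) :=
  LinearMap.pi fun k => f k ∘ₗ LinearMap.proj (k + m)

/-- The operator which is `k - n` in degree `k`. -/
def weight (F : ℕ → Type*) [∀ k, AddCommGroup (F k)] [∀ k, Module ℝ (F k)] (n : ℕ) :
    Module.End ℝ (∀ k, F k) :=
  LinearMap.pi fun k => ((k : ℝ) - n) • LinearMap.proj k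

section

variable (f : ∀ k, F k →ₗ[ℝ] F (k + 1)) (g : ∀ k, F k →ₗ[ℝ] F (k + 2)) (x : ∀ k, F k) (k : ℕ)

@[simp] theorem raise_zero : raise f x 0 = 0 := rfl

@[simp] theorem raise_succ : raise f x (k + 1) = f k (x k) := rfl

@[simp] theorem raiseTwo_zero : raiseTwo g x 0 = 0 := rfl

@[simp] theorem raiseTwo_one : raiseTwo g x 1 = 0 := rfl

@[simp] theorem raiseTwo_add_two : raiseTwo g x (k + 2) = g k (x k) := rfl

@[simp] theorem lower_apply (m : ℕ) (f : ∀ k, F (k + m) →ₗ[ℝ] F k) :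
    lower m f x k = f k (x (k + m)) := rfl

@[simp] theorem weight_apply (n : ℕ) : weight F n x k = ((k : ℝ) - n) • x k := rfl

end

/-- Eigenvectors of the weight operator are concentrated in a single degree, so weight conditions
stand for degrees without transporting along equalities of indices. -/
theorem weight_eq_smul_iff {n : ℕ} {r : ℝ} {x : ∀ k, F k} :
    weight F n x = r • x ↔ ∀ k : ℕ, (k : ℝ) - n ≠ r → x k = 0 := by
  rw [funext_iff]
  refine forall_congr' fun k => ?_
  rw [weight_apply, Pi.smul_apply, ← sub_eq_zero, ← sub_smul, smul_eq_zero, sub_eq_zero]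
  tauto

theorem weight_single {n k : ℕ} {r : ℝ} (hr : (k : ℝ) - n = r) (x : F k) :
    weight F n (Pi.single k x) = r • (Pi.single k x : ∀ k, F k) := by
  rw [weight_eq_smul_iff]
  intro j hj
  refine Pi.single_eq_of_ne (fun h => hj ?_) x
  rw [h, hr]

theorem eq_single {n k : ℕ} {r : ℝ} (hr : (k : ℝ) - n = r) {x : ∀ k, F k}
    (hx : weight F n x = r • x) : x = Pi.single k (x k) := by
  funext j
  by_cases h : j = k
  · subst h; simp
  · rw [Pi.single_eq_of_ne h]
    refine weight_eq_smul_iff.1 hx j fun h' => h ?_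
    have : (j : ℝ) = k := by linarith
    exact_mod_cast this

theorem weight_mul_raise (n : ℕ) (f : ∀ k, F k →ₗ[ℝ] F (k + 1)) :
    weight F n * raise f = raise f * weight F n + raise f := by
  refine LinearMap.ext fun x => funext fun k => ?_
  cases k with
  | zero => simp
  | succ k => simp; module

/-- The `sl₂`-triple of a graded space with operators of degree `±2`. -/
theorem lefschetzTriple {n : ℕ} (hF : ∀ k, 2 * n < k → ∀ x : F k, x = 0)
    (f : ∀ k, F k →ₗ[ℝ] F (k + 2)) (g : ∀ k, F (k + 2) →ₗ[ℝ] F k)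
    (h : lower 2 g * raiseTwo f = raiseTwo f * lower 2 g + weight F n) :
    LefschetzTriple n (raiseTwo f) (lower 2 g) (weight F n) where
  H_mul_L := by
    refine LinearMap.ext fun x => funext fun k => ?_
    match k with
    | 0 => simp
    | 1 => simp
    | k + 2 => simp; module
  H_mul_Λ := by
    refine LinearMap.ext fun x => funext fun k => ?_
    simp; module
  Λ_mul_L := h
  eq_zero_of_lt r hr x hx := by
    funext k
    by_cases hk : 2 * n < k
    · exact hF k hk _
    · refine weight_eq_smul_iff.1 hx k fun e => ?_
      have : (k : ℤ) - n = r := by exact_mod_cast e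
      subst this
      rw [lt_abs] at hr
      omega
  eq_top S hS := by
    rw [eq_top_iff]
    intro x _
    -- The total space is a product over all degrees; vanishing above `2 * n` makes it a finite
    -- direct sum of weight spaces.
    have : x = ∑ k ∈ Finset.range (2 * n + 1), Pi.single k (x k) := by
      funext j
      rw [Finset.sum_apply]
      by_cases hj : j < 2 * n + 1
      · rw [Finset.sum_eq_single_of_mem j (Finset.mem_range.2 hj) fun i _ hi =>
          Pi.single_eq_of_ne hi.symm _]
        simp
      · exact (hF j (by omega) _).trans (hF j (by omega) _).symm
    rw [this]
    exact sum_mem fun k _ => hS (k - n) _ (weight_single (by push_cast; rfl) _)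

end Graded

namespace Graded

variable {F : ℕ → Type*} [∀ k, AddCommGroup (F k)] [∀ k, Module ℝ (F k)]

theorem raise_single (f : ∀ k, F k →ₗ[ℝ] F (k + 1)) (k : ℕ) (x : F k) :
    raise f (Pi.single k x) = Pi.single (k + 1) (f k x) := by
  funext j
  cases j with
  | zero => simp
  | succ j =>
    by_cases h : j = k
    · subst h; simp
    · rw [Pi.single_eq_of_ne (by simpa using h), raise_succ, Pi.single_eq_of_ne h, map_zero]

theorem raiseTwo_single (f : ∀ k, F k →ₗ[ℝ] F (k + 2)) (k : ℕ) (x : F k) :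
    raiseTwo f (Pi.single k x) = Pi.single (k + 2) (f k x) := by
  funext j
  match j with
  | 0 => simp
  | 1 => rw [raiseTwo_one, Pi.single_eq_of_ne (by omega)]
  | j + 2 =>
    by_cases h : j = k
    · subst h; simp
    · rw [Pi.single_eq_of_ne (by simpa using h), raiseTwo_add_two, Pi.single_eq_of_ne h, map_zero]

end Graded

namespace AltForm

variable {E : Type*} [NormedAddCommGroup E] [NormedSpace ℝ E]

/-! ### Interior and exterior multiplication on the space of all forms -/

/-- Interior multiplication `ι_v`. -/
noncomputable def int : E →ₗ[ℝ] Module.End ℝ (∀ k, AltForm E k) where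
  toFun v := Graded.lower 1 fun k =>
    { toFun := fun α => α.curryLeft v
      map_add' := fun _ _ => rfl
      map_smul' := fun _ _ => rfl }
  map_add' u v := by
    refine LinearMap.ext fun x => funext fun k => ?_
    exact (x (k + 1)).curryLeft.map_add u v
  map_smul' c v := by
    refine LinearMap.ext fun x => funext fun k => ?_
    exact (x (k + 1)).curryLeft.map_smul c v

/-- Exterior multiplication with `θ` in degree `k`. -/
noncomputable def extMul (θ : E →L[ℝ] ℝ) (k : ℕ) : AltForm E k →ₗ[ℝ] AltForm E (k + 1) :=
  (ContinuousAlternatingMap.alternatizeUncurryFinCLM ℝ E ℝ ∘L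
    ContinuousLinearMap.smulRightL ℝ E (AltForm E k) θ).toLinearMap

theorem extMul_apply (θ : E →L[ℝ] ℝ) (k : ℕ) (α : AltForm E k) :
    extMul θ k α = ContinuousAlternatingMap.alternatizeUncurryFin (θ.smulRight α) := rfl

theorem extMul_apply_apply (θ : E →L[ℝ] ℝ) (k : ℕ) (α : AltForm E k) (u : Fin (k + 1) → E) :
    extMul θ k α u = ∑ i : Fin (k + 1), (-1) ^ (i : ℕ) * (θ (u i) * α (i.removeNth u)) := by
  simp [extMul_apply, ContinuousAlternatingMap.alternatizeUncurryFin_apply]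

/-- Exterior multiplication with `θ`. -/
noncomputable def ext : (E →L[ℝ] ℝ) →ₗ[ℝ] Module.End ℝ (∀ k, AltForm E k) where
  toFun θ := Graded.raise (extMul θ)
  map_add' θ η := by
    refine LinearMap.ext fun x => funext fun k => ?_
    cases k with
    | zero => exact (add_zero (0 : AltForm E 0)).symm
    | succ k => simp [extMul]
  map_smul' c θ := by
    refine LinearMap.ext fun x => funext fun k => ?_
    cases k with
    | zero => exact (smul_zero (A := AltForm E 0) c).symm
    | succ k => simp [extMul]

@[simp] theorem int_apply (v : E) (x : ∀ k, AltForm E k) (k : ℕ) :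
    int v x k = (x (k + 1)).curryLeft v := rfl

@[simp] theorem ext_zero (θ : E →L[ℝ] ℝ) (x : ∀ k, AltForm E k) : ext θ x 0 = 0 := rfl

@[simp] theorem ext_succ (θ : E →L[ℝ] ℝ) (x : ∀ k, AltForm E k) (k : ℕ) :
    ext θ x (k + 1) = extMul θ k (x k) := rfl

/-- Polarization of `ι_w ι_w = 0`. -/
theorem int_mul_int (u v : E) : int u * int v = -(int v * int u) := by
  have h : ∀ w : E, int w * int w = 0 := fun w => by
    refine LinearMap.ext fun x => funext fun k => ?_
    exact ContinuousAlternatingMap.curryLeft_same _ _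
  have := h (u + v)
  rw [map_add, add_mul, mul_add, mul_add, h, h, zero_add, add_zero] at this
  exact eq_neg_of_add_eq_zero_left this

/-- Polarization of `ζ ∧ ζ ∧ α = 0`, which holds because alternatization kills the symmetric form `ζ
⊗ ζ`. -/
theorem ext_mul_ext (θ η : E →L[ℝ] ℝ) : ext θ * ext η = -(ext η * ext θ) := by
  have h : ∀ ζ : E →L[ℝ] ℝ, ext ζ * ext ζ = 0 := fun ζ => by
    refine LinearMap.ext fun x => funext fun k => ?_
    match k with
    | 0 => rfl
    | 1 =>
      change extMul ζ 0 0 = 0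
      exact map_zero _
    | k + 2 =>
      have := ContinuousAlternatingMap.alternatizeUncurryFin_alternatizeUncurryFinCLM_comp_of_symmetric
        (f := tmul (ζ.smulRight ζ) (x k)) fun u w => by simp [mul_comm]
      change extMul ζ (k + 1) (extMul ζ k (x k)) = 0
      rw [← this, extMul_apply]
      congr 1
      refine ContinuousLinearMap.ext fun u => ?_
      change ζ u • extMul ζ k (x k) = ContinuousAlternatingMap.alternatizeUncurryFin _
      rw [extMul_apply, ← ContinuousAlternatingMap.alternatizeUncurryFin_smul]
      congr 1
      ext1 w
      simp [smul_smul]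
  have := h (θ + η)
  rw [map_add, add_mul, mul_add, mul_add, h, h, zero_add, add_zero] at this
  exact eq_neg_of_add_eq_zero_left this

theorem removeNth_succ_vecCons {S : Type*} {k : ℕ} (v : S) (u : Fin (k + 1) → S) (i : Fin (k + 1)) :
    i.succ.removeNth (Matrix.vecCons v u) = Matrix.vecCons v (i.removeNth u) := by
  funext j
  refine Fin.cases ?_ (fun j => ?_) j <;> simp [Fin.removeNth]

/-- In the alternating sum for `θ ∧ α` with `v` in the first slot, the term where `θ` takes `v`
gives `θ v`; the others give `θ ∧ ι_v α` with one sign change. -/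
theorem int_mul_ext (v : E) (θ : E →L[ℝ] ℝ) :
    int v * ext θ = θ v • (1 : Module.End ℝ (∀ k, AltForm E k)) - ext θ * int v := by
  refine LinearMap.ext fun x => funext fun k => ?_
  change (extMul θ k (x k)).curryLeft v = θ v • x k - ext θ (int v x) k
  refine ContinuousAlternatingMap.ext fun u => ?_
  rw [ContinuousAlternatingMap.curryLeft_apply_apply, extMul_apply_apply, Fin.sum_univ_succ]
  cases k with
  | zero => simp [Fin.removeNth_zero]
  | succ k =>
    rw [ext_succ, ContinuousAlternatingMap.sub_apply, extMul_apply_apply]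
    simp only [removeNth_succ_vecCons, int_apply, ContinuousAlternatingMap.curryLeft_apply_apply,
      Fin.val_succ, pow_succ, Matrix.cons_val_succ]
    simp [Fin.removeNth_zero, sub_eq_add_neg]

theorem int_mul_ext_mul_ext (v : E) (θ η : E →L[ℝ] ℝ) :
    int v * (ext θ * ext η) = ext θ * ext η * int v + (θ v • ext η - η v • ext θ) := by
  rw [← mul_assoc, int_mul_ext, sub_mul, mul_assoc (ext θ), int_mul_ext, smul_mul_assoc, one_mul,
    mul_sub, mul_smul_comm, mul_one]
  simp only [← mul_assoc]
  abel

theorem int_mul_int_mul_ext (u v : E) (θ : E →L[ℝ] ℝ) :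
    int u * int v * ext θ = ext θ * (int u * int v) + (θ v • int u - θ u • int v) := by
  rw [mul_assoc, int_mul_ext, mul_sub, ← mul_assoc, int_mul_ext, sub_mul, mul_smul_comm, mul_one,
    smul_mul_assoc, one_mul, mul_assoc]
  abel

/-! ### Dual bases -/

section Basis

variable {κ κ' : Type*} [Fintype κ] [Fintype κ'] [FiniteDimensional ℝ E]

/-- The coordinates with respect to a basis. -/
noncomputable def coordL (b : Module.Basis κ ℝ E) (a : κ) : E →L[ℝ] ℝ :=
  LinearMap.toContinuousLinearMap (b.coord a)

theorem sum_coordL_smul (b : Module.Basis κ ℝ E) (v : E) : ∑ a, coordL b a v • b a = v :=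
  b.sum_repr v

theorem sum_smul_coordL (b : Module.Basis κ ℝ E) (θ : E →L[ℝ] ℝ) : ∑ a, θ (b a) • coordL b a = θ := by
  ext v
  conv_rhs => rw [← sum_coordL_smul b v]
  simp [mul_comm]

/-- The element `∑ e^a ⊗ e_a` of `E^* ⊗ E` is canonical. This makes the dual Lefschetz operator,
defined through a chosen basis, natural. -/
theorem sum_bilin_basis {Y : Type*} [AddCommGroup Y] [Module ℝ Y]
    (g : (E →L[ℝ] ℝ) →ₗ[ℝ] E →ₗ[ℝ] Y) (b : Module.Basis κ ℝ E) (c : Module.Basis κ' ℝ E) :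
    ∑ a, g (coordL b a) (b a) = ∑ a, g (coordL c a) (c a) := by
  have h : ∀ a, g (coordL b a) (b a) = ∑ i, coordL c i (b a) • g (coordL b a) (c i) := fun a => by
    conv_lhs => rw [← sum_coordL_smul c (b a)]
    simp only [map_sum, map_smul]
  have h' : ∀ i, g (coordL c i) (c i) = ∑ a, coordL c i (b a) • g (coordL b a) (c i) := fun i => by
    conv_lhs => rw [← sum_smul_coordL b (coordL c i)]
    simp only [map_sum, map_smul, LinearMap.sum_apply, LinearMap.smul_apply]
  simp only [h, h']
  exact Finset.sum_comm

end Basis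

variable [FiniteDimensional ℝ E]

theorem bil_swap (ω : AltForm E 2) (u v : E) : bil ω u v = -bil ω v u := by
  rw [bil_apply, bil_apply]
  have := ω.toAlternatingMap.map_swap ![v, u] (i := 0) (j := 1) (by simp)
  have h : (![v, u] ∘ Equiv.swap (0 : Fin 2) 1) = ![u, v] := by
    funext i; fin_cases i <;> simp
  rw [h] at this
  exact this

/-- The inverse of `v ↦ ω(v, ·)`. -/
noncomputable def vecSharp (ω : AltForm E 2) : (E →L[ℝ] ℝ) →L[ℝ] E := (bil ω).inverse

/-- The isomorphism `v ↦ ω(v, ·)` of a nondegenerate form. -/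
noncomputable def bilEquiv {ω : AltForm E 2} (hω : Nondegenerate ω) : E ≃L[ℝ] (E →L[ℝ] ℝ) :=
  (LinearEquiv.ofInjectiveOfFinrankEq (bil ω).toLinearMap
    ((injective_iff_map_eq_zero _).2 fun v hv => hω v fun w => by
      rw [← bil_apply]; exact congrArg (fun f : E →L[ℝ] ℝ => f w) hv)
    ((Subspace.dual_finrank_eq (K := ℝ) (V := E)).symm.trans
      (LinearMap.toContinuousLinearMap (𝕜 := ℝ) (E := E) (F' := ℝ)).finrank_eq)).toContinuousLinearEquiv

theorem coe_bilEquiv {ω : AltForm E 2} (hω : Nondegenerate ω) :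
    (bilEquiv hω : E →L[ℝ] (E →L[ℝ] ℝ)) = bil ω := rfl

theorem vecSharp_eq {ω : AltForm E 2} (hω : Nondegenerate ω) :
    vecSharp ω = (bilEquiv hω).symm := by
  rw [vecSharp, ← coe_bilEquiv hω, ContinuousLinearMap.inverse_equiv]

theorem vecSharp_bil {ω : AltForm E 2} (hω : Nondegenerate ω) (v : E) :
    vecSharp ω (bil ω v) = v := by
  rw [vecSharp_eq hω]
  exact (bilEquiv hω).symm_apply_apply v

theorem bil_vecSharp {ω : AltForm E 2} (hω : Nondegenerate ω) (θ : E →L[ℝ] ℝ) :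
    bil ω (vecSharp ω θ) = θ := by
  rw [vecSharp_eq hω]
  exact (bilEquiv hω).apply_symm_apply θ

theorem sum_bil_smul_coordL {κ : Type*} [Fintype κ] (ω : AltForm E 2) (b : Module.Basis κ ℝ E)
    (v : E) : ∑ a, bil ω (b a) v • coordL b a = -bil ω v := by
  rw [← sum_smul_coordL b (bil ω v), ← Finset.sum_neg_distrib]
  exact Finset.sum_congr rfl fun a _ => by rw [bil_swap, neg_smul]

/-- The covectors `ω(e_a, ·)` and the vectors `ω♯ e^a` are dual bases up to the sign coming from
antisymmetry, so they give minus the canonical element. -/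
theorem sum_bilin_bil {κ : Type*} [Fintype κ] {ω : AltForm E 2} (hω : Nondegenerate ω)
    (b : Module.Basis κ ℝ E) {Y : Type*} [AddCommGroup Y] [Module ℝ Y]
    (g : (E →L[ℝ] ℝ) →ₗ[ℝ] E →ₗ[ℝ] Y) :
    ∑ a, g (bil ω (b a)) (vecSharp ω (coordL b a)) = -∑ a, g (coordL b a) (b a) := by
  have h : ∀ a, g (bil ω (b a)) (vecSharp ω (coordL b a)) =
      ∑ c, bil ω (b a) (b c) • g (coordL b c) (vecSharp ω (coordL b a)) := fun a => by
    conv_lhs => rw [← sum_smul_coordL b (bil ω (b a))]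
    simp only [map_sum, map_smul, LinearMap.sum_apply, LinearMap.smul_apply]
  simp only [h]
  rw [Finset.sum_comm, ← Finset.sum_neg_distrib]
  refine Finset.sum_congr rfl fun c _ => ?_
  simp only [← map_smul, ← map_sum, sum_bil_smul_coordL]
  rw [map_neg, vecSharp_bil hω, map_neg]

end AltForm

namespace AltForm

variable {E : Type*} [NormedAddCommGroup E] [NormedSpace ℝ E] [FiniteDimensional ℝ E]

/-! ### The Lefschetz operator and its dual -/

/-- The operator `α ↦ ω ∧ α` on the space of all forms. -/
noncomputable def lefschetz (ω : AltForm E 2) : Module.End ℝ (∀ k, AltForm E k) :=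
  Graded.raiseTwo fun k => (wedgeL (Nat.add_comm 2 k) ω).toLinearMap

/-- Contraction with the bivector dual to `ω`, up to the sign. -/
noncomputable def dualLefschetzL (ω : AltForm E 2) (k : ℕ) : AltForm E (k + 2) →ₗ[ℝ] AltForm E k where
  toFun α := (2 : ℝ)⁻¹ • ∑ a, (α.curryLeft (Module.finBasis ℝ E a)).curryLeft
    (vecSharp ω (coordL (Module.finBasis ℝ E) a))
  map_add' α β := by
    simp only [ContinuousAlternatingMap.curryLeft_add, add_apply,
      Finset.sum_add_distrib, smul_add]
  map_smul' c α := by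
    simp only [ContinuousAlternatingMap.curryLeft_smul, smul_apply,
      ← Finset.smul_sum, RingHom.id_apply, smul_comm c]

theorem dualLefschetzL_apply (ω : AltForm E 2) (k : ℕ) (α : AltForm E (k + 2)) :
    dualLefschetzL ω k α = (2 : ℝ)⁻¹ • ∑ a,
      (α.curryLeft (Module.finBasis ℝ E a)).curryLeft
        (vecSharp ω (coordL (Module.finBasis ℝ E) a)) := rfl

/-- The dual Lefschetz operator on the space of all forms. -/
noncomputable def dualLefschetz (ω : AltForm E 2) : Module.End ℝ (∀ k, AltForm E k) :=
  Graded.lower 2 (dualLefschetzL ω)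

/-- Expresses `ω = ½ ∑ e^a ∧ ω(e_a, ·)`, which reduces commutators with `L` to the Clifford
relations between `ext` and `int`. -/
theorem lefschetz_eq {κ : Type*} [Fintype κ] (b : Module.Basis κ ℝ E) (ω : AltForm E 2) :
    lefschetz ω = (2 : ℝ)⁻¹ • ∑ a, ext (coordL b a) * ext (bil ω (b a)) := by
  refine LinearMap.ext fun x => funext fun k => ?_
  simp only [LinearMap.smul_apply, LinearMap.sum_apply, Pi.smul_apply, Finset.sum_apply]
  match k with
  | 0 => simp [lefschetz]
  | 1 =>
    have : ∀ θ : E →L[ℝ] ℝ, extMul θ 0 (0 : AltForm E 0) = 0 := fun θ => map_zero _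
    simp [lefschetz, this]
  | k + 2 =>
    change wedge (Nat.add_comm 2 k) ω (x k) =
      (2 : ℝ)⁻¹ • ∑ a, extMul (coordL b a) (k + 1) (extMul (bil ω (b a)) k (x k))
    rw [wedge_two]
    congr 1
    simp only [extMul_apply (coordL _ _), alt₂,
      ← ContinuousAlternatingMap.alternatizeUncurryFinCLM_apply]
    rw [← map_sum]
    congr 1
    refine ContinuousLinearMap.ext fun u => ?_
    have h1 : ∀ v, (ContinuousAlternatingMap.alternatizeUncurryFinCLM ℝ E ℝ ∘L
        tmul (bil ω) (x k)) v = ext (bil ω v) x (k + 1) := fun v => by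
      change ContinuousAlternatingMap.alternatizeUncurryFin _ = extMul _ _ _
      rw [extMul_apply]
      congr 1
    rw [h1]
    conv_lhs => rw [← sum_coordL_smul b u]
    simp [map_sum, LinearMap.sum_apply, Finset.sum_apply]

theorem dualLefschetz_eq (ω : AltForm E 2) :
    dualLefschetz ω = (2 : ℝ)⁻¹ • ∑ a, int (vecSharp ω (coordL (Module.finBasis ℝ E) a)) *
      int (Module.finBasis ℝ E a) := by
  refine LinearMap.ext fun x => funext fun k => ?_
  simp only [LinearMap.smul_apply, LinearMap.sum_apply, Pi.smul_apply, Finset.sum_apply]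
  exact dualLefschetzL_apply ω k (x (k + 2))

/-- Interior multiplication is an antiderivation and `ι_v ω = ω(v, ·)`. Each of the two factors in
`lefschetz_eq` contributes half. -/
theorem int_mul_lefschetz (ω : AltForm E 2) (v : E) :
    int v * lefschetz ω = lefschetz ω * int v + ext (bil ω v) := by
  let b := Module.finBasis ℝ E
  rw [lefschetz_eq b, mul_smul_comm, smul_mul_assoc, Finset.mul_sum, Finset.sum_mul]
  simp only [int_mul_ext_mul_ext, Finset.sum_add_distrib, Finset.sum_sub_distrib]
  simp only [← map_smul, ← map_sum, sum_coordL_smul, sum_bil_smul_coordL]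
  rw [map_neg]
  module

theorem int_mul_dualLefschetz (ω : AltForm E 2) (v : E) :
    int v * dualLefschetz ω = dualLefschetz ω * int v := by
  rw [dualLefschetz_eq, mul_smul_comm, smul_mul_assoc, Finset.mul_sum, Finset.sum_mul]
  congr 1
  refine Finset.sum_congr rfl fun a _ => ?_
  rw [← mul_assoc, int_mul_int v, neg_mul, mul_assoc, int_mul_int v, mul_neg, neg_neg, mul_assoc]

theorem ext_mul_lefschetz (ω : AltForm E 2) (θ : E →L[ℝ] ℝ) :
    ext θ * lefschetz ω = lefschetz ω * ext θ := by
  rw [lefschetz_eq (Module.finBasis ℝ E), mul_smul_comm, smul_mul_assoc, Finset.mul_sum,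
    Finset.sum_mul]
  congr 1
  refine Finset.sum_congr rfl fun a _ => ?_
  rw [← mul_assoc, ext_mul_ext θ, neg_mul, mul_assoc, ext_mul_ext θ, mul_neg, neg_neg, mul_assoc]

/-- Counterpart of `int_mul_lefschetz`: together they say that `L` and `Λ` rotate `ι_v` and `ω(v, ·)
∧` into each other. -/
theorem ext_mul_dualLefschetz {ω : AltForm E 2} (hω : Nondegenerate ω) (v : E) :
    ext (bil ω v) * dualLefschetz ω = dualLefschetz ω * ext (bil ω v) + -int v := by
  rw [dualLefschetz_eq, mul_smul_comm, smul_mul_assoc, Finset.mul_sum, Finset.sum_mul]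
  simp only [int_mul_int_mul_ext, Finset.sum_add_distrib, Finset.sum_sub_distrib]
  have h : ∀ a, bil ω v (vecSharp ω (coordL (Module.finBasis ℝ E) a)) =
      -coordL (Module.finBasis ℝ E) a v := fun a => by rw [bil_swap, bil_vecSharp hω]
  simp only [h, neg_smul, Finset.sum_neg_distrib]
  simp only [← map_smul, ← map_sum, sum_coordL_smul, sum_smul_coordL]
  rw [vecSharp_bil hω]
  module

theorem eq_zero_of_finrank_lt {k : ℕ} (hk : Module.finrank ℝ E < k) (α : AltForm E k) : α = 0 := by
  ext u
  refine α.toAlternatingMap.map_linearDependent u fun h => ?_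
  have := h.fintype_card_le_finrank
  simp at this
  omega

/-- The operator `∑_a e_a ∧ ι_{e_a}` is multiplication by the degree. -/
theorem sum_ext_mul_int {κ : Type*} [Fintype κ] (b : Module.Basis κ ℝ E) :
    ∑ a, ext (coordL b a) * int (b a) = Graded.weight (AltForm E) 0 := by
  refine LinearMap.ext fun x => funext fun k => ?_
  rw [LinearMap.sum_apply, Finset.sum_apply]
  cases k with
  | zero => simp
  | succ k =>
    have := ContinuousAlternatingMap.alternatizeUncurryFin_curryLeft (x (k + 1))
    change ∑ a, extMul (coordL b a) k ((x (k + 1)).curryLeft (b a)) = _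
    simp only [extMul_apply, ← ContinuousAlternatingMap.alternatizeUncurryFinCLM_apply] at this ⊢
    rw [← map_sum]
    have e : ∑ a, (coordL b a).smulRight ((x (k + 1)).curryLeft (b a)) = (x (k + 1)).curryLeft := by
      refine ContinuousLinearMap.ext fun u => ?_
      conv_rhs => rw [← sum_coordL_smul b u]
      simp [map_sum]
    rw [e, this, Graded.weight_apply, ← Nat.cast_smul_eq_nsmul ℝ]
    push_cast
    simp

/-- Commuting `L` past the two contractions in `Λ` yields the degree operator, the constant `-2n`,
and the degree operator once more by `sum_bilin_bil`; the factor `½` leaves degree minus `n`. -/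
theorem lefschetzTriple {n : ℕ} (hE : Module.finrank ℝ E = 2 * n) {ω : AltForm E 2}
    (hω : Nondegenerate ω) :
    LefschetzTriple n (lefschetz ω) (dualLefschetz ω) (Graded.weight (AltForm E) n) := by
  refine Graded.lefschetzTriple (fun k hk x => eq_zero_of_finrank_lt (hE ▸ hk) x) _ _ ?_
  change dualLefschetz ω * lefschetz ω = lefschetz ω * dualLefschetz ω + _
  let b := Module.finBasis ℝ E
  have h1 : ∀ a, int (vecSharp ω (coordL b a)) * int (b a) * lefschetz ω =
      lefschetz ω * (int (vecSharp ω (coordL b a)) * int (b a)) + (ext (coordL b a) * int (b a) +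
        (-1 - ext (bil ω (b a)) * int (vecSharp ω (coordL b a)))) := fun a => by
    rw [mul_assoc, int_mul_lefschetz, mul_add, int_mul_ext, ← mul_assoc, int_mul_lefschetz,
      bil_vecSharp hω, bil_swap, bil_vecSharp hω, add_mul, mul_assoc]
    have : coordL b a (b a) = 1 := by simp [coordL]
    rw [this]
    module
  have h2 := sum_bilin_bil hω b ((LinearMap.mul ℝ (Module.End ℝ (∀ k, AltForm E k))).compl₁₂
    (ext (E := E)) int)
  simp only [LinearMap.compl₁₂_apply, LinearMap.mul_apply', sum_ext_mul_int] at h2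
  have h3 : Graded.weight (AltForm E) n = Graded.weight (AltForm E) 0 - (n : ℝ) • 1 := by
    refine LinearMap.ext fun x => funext fun k => ?_
    simp [sub_smul]
  rw [dualLefschetz_eq, smul_mul_assoc, Finset.sum_mul, mul_smul_comm, Finset.mul_sum]
  simp only [b] at h1 h2
  simp only [h1, Finset.sum_add_distrib, Finset.sum_sub_distrib, sum_ext_mul_int, h2, h3]
  simp only [Finset.sum_const, Finset.card_univ, Fintype.card_fin, hE,
    ← Nat.cast_smul_eq_nsmul ℝ]
  push_cast
  module

end AltForm

namespace AltForm

variable {E : Type*} [NormedAddCommGroup E] [NormedSpace ℝ E] [FiniteDimensional ℝ E]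

/-! ### The symplectic star operator in terms of the Lefschetz operators -/

/-- The operator `e^L e^Λ`. -/
noncomputable def expExp (n : ℕ) (ω : AltForm E 2) : Module.End ℝ (∀ k, AltForm E k) :=
  truncExp (n + 1) (lefschetz ω) * truncExp (n + 1) (dualLefschetz ω)

/-- Moving `ι_v` past `e^L` gives `ι_v + ω(v, ·) ∧`; moving this past `e^Λ` cancels the term `ι_v`.
-/
theorem int_expExp {n : ℕ} (hE : Module.finrank ℝ E = 2 * n) {ω : AltForm E 2}
    (hω : Nondegenerate ω) (v : E) (x : ∀ k, AltForm E k) :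
    int v (expExp n ω x) = expExp n ω (ext (bil ω v) x) := by
  have T := lefschetzTriple hE hω
  have h1 := mul_truncExp T.pow_eq_zero (int_mul_lefschetz ω v) (ext_mul_lefschetz ω _)
  have h2 := mul_truncExp (B := 0) (D := int v) T.swap.pow_eq_zero
    (by rw [int_mul_dualLefschetz, add_zero]) (by simp)
  have h3 := mul_truncExp T.swap.pow_eq_zero (ext_mul_dualLefschetz hω v)
    (by rw [neg_mul, mul_neg, int_mul_dualLefschetz])
  have : int v * expExp n ω = expExp n ω * ext (bil ω v) := by
    rw [expExp, ← mul_assoc, h1, mul_assoc, add_mul, h2, h3, mul_assoc]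
    noncomm_ring
  exact LinearMap.congr_fun this x

theorem lefschetz_pow_single_one (ω : AltForm E 2) (j : ℕ) :
    (lefschetz ω ^ j) (Pi.single 0 (ContinuousAlternatingMap.constOfIsEmpty ℝ E (Fin 0) 1)) =
      Pi.single (2 * j) (pow ω j) := by
  induction j with
  | zero => rfl
  | succ j ih =>
    rw [pow_succ', Module.End.mul_apply, ih, lefschetz, Graded.raiseTwo_single]
    rfl

theorem dualLefschetz_pow_single_zero (ω : AltForm E 2) (j : ℕ) (α : AltForm E 0) :
    (dualLefschetz ω ^ (j + 1)) (Pi.single 0 α) = 0 := by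
  have : dualLefschetz ω (Pi.single 0 α) = 0 := by
    refine funext fun k => ?_
    rw [dualLefschetz, Graded.lower_apply, Pi.single_eq_of_ne (by omega), map_zero]
    rfl
  rw [pow_succ, Module.End.mul_apply, this, map_zero]

/-- `Λ` kills constants, so `e^L e^Λ 1 = e^ω`, whose component of degree `2 * n` is the volume form.
-/
theorem expExp_single_one (n : ℕ) (ω : AltForm E 2) :
    expExp n ω (Pi.single 0 (ContinuousAlternatingMap.constOfIsEmpty ℝ E (Fin 0) 1)) (2 * n) =
      vol n ω := by
  rw [expExp, Module.End.mul_apply, truncExp_apply (n + 1) (dualLefschetz ω),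
    Finset.sum_range_succ']
  simp only [dualLefschetz_pow_single_zero, smul_zero, Finset.sum_const_zero, zero_add]
  simp only [Nat.factorial_zero, Nat.cast_one, inv_one, pow_zero, Module.End.one_apply, one_smul]
  rw [truncExp_apply, Finset.sum_apply, Finset.sum_eq_single_of_mem n (by simp)]
  · rw [lefschetz_pow_single_one, Pi.smul_apply, Pi.single_eq_same]
    rfl
  · intro j _ hj
    rw [lefschetz_pow_single_one, Pi.smul_apply, Pi.single_eq_of_ne (by omega), smul_zero]

/-- Laplace expansion of the determinant along its last row. -/
theorem flatVec_snoc (ω : AltForm E 2) {p : ℕ} (w : Fin p → E) (v : E) :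
    flatVec ω (Fin.snoc w v : Fin (p + 1) → E) =
      (-1 : ℝ) ^ p • extMul (bil ω v) p (flatVec ω w) := by
  ext u
  rw [flatVec_apply, Matrix.det_succ_row _ (Fin.last p), ContinuousAlternatingMap.smul_apply,
    extMul_apply_apply, smul_eq_mul, Finset.mul_sum]
  refine Finset.sum_congr rfl fun j _ => ?_
  rw [flatVec_apply, bil_apply, pow_add, mul_assoc, mul_assoc]
  simp only [Matrix.of_apply, Fin.snoc_last, Fin.val_last]
  congr 4
  ext a b
  simp [Fin.removeNth]

omit [FiniteDimensional ℝ E] in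
theorem contractVec_snoc {p q r : ℕ} (h : p + 1 + q = r) (h' : p + (q + 1) = r) (η : AltForm E r)
    (w : Fin p → E) (v : E) :
    contractVec h η (Fin.snoc w v : Fin (p + 1) → E) = (contractVec h' η w).curryLeft v := by
  ext u
  rw [contractVec_apply, ContinuousAlternatingMap.curryLeft_apply_apply, contractVec_apply,
    Fin.append_left_snoc]
  rfl

/-- Start from `expExp_single_one` and contract one vector at a time: by `int_expExp` each
contraction becomes an exterior multiplication inside `e^L e^Λ`. Moving the new factor past the `p`
earlier ones costs `(-1)^p`, and these signs accumulate to the exponent `p.choose 2`. -/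
theorem contractVec_vol {n : ℕ} (hE : Module.finrank ℝ E = 2 * n) {ω : AltForm E 2}
    (hω : Nondegenerate ω) {p q : ℕ} (h : p + q = 2 * n) (w : Fin p → E) :
    contractVec h (vol n ω) w =
      (-1 : ℝ) ^ (p.choose 2) • expExp n ω (Pi.single p (flatVec ω w)) q := by
  induction p generalizing q with
  | zero =>
    obtain rfl : q = 2 * n := by omega
    have : flatVec ω w = ContinuousAlternatingMap.constOfIsEmpty ℝ E (Fin 0) 1 := by
      ext u
      simp [flatVec_apply]
    rw [this, expExp_single_one]
    ext u
    rw [contractVec_apply]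
    simp only [Nat.choose_zero_succ, pow_zero, one_smul]
    congr 1
    funext i
    have : w = Fin.elim0 := Subsingleton.elim _ _
    rw [this, Fin.elim0_append]
    simp
  | succ p ih =>
    rw [← Fin.snoc_init_self w, contractVec_snoc h (by omega), ih, flatVec_snoc]
    have e : (Pi.single (p + 1) ((-1 : ℝ) ^ p • extMul (bil ω (w (Fin.last p))) p
        (flatVec ω (Fin.init w))) : ∀ k, AltForm E k) =
        (-1 : ℝ) ^ p • ext (bil ω (w (Fin.last p))) (Pi.single p (flatVec ω (Fin.init w))) := by
      rw [Pi.single_smul]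
      congr 1
      exact (Graded.raise_single _ _ _).symm
    rw [e, map_smul, ← int_expExp hE hω, ContinuousAlternatingMap.curryLeft_smul,
      Nat.choose_succ_succ, Nat.choose_one_right, Pi.smul_apply, smul_smul, pow_add, mul_comm,
      ← mul_assoc, ← pow_add, Even.neg_one_pow ⟨p, rfl⟩, one_mul]
    rfl

/-- Both sides are linear in the multivector `sharp ω α`, so `contractVec_vol` on decomposable
multivectors suffices. -/
theorem star_eq {n : ℕ} (hE : Module.finrank ℝ E = 2 * n) {ω : AltForm E 2}
    (hω : Nondegenerate ω) {p q : ℕ} (h : p + q = 2 * n) (α : AltForm E p) :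
    star n h ω α = (-1 : ℝ) ^ (p.choose 2) • expExp n ω (Pi.single p α) q := by
  have key : contract h (vol n ω) = (-1 : ℝ) ^ (p.choose 2) •
      (LinearMap.proj q ∘ₗ expExp n ω ∘ₗ LinearMap.single ℝ (AltForm E) p ∘ₗ flat ω p) := by
    refine exteriorPower.linearMap_ext (AlternatingMap.ext fun w => ?_)
    have h1 : contract h (vol n ω) (exteriorPower.ιMulti ℝ p w) = contractVec h (vol n ω) w := by
      ext u; rw [contract_ιMulti, contractVec_apply]
    have h2 : flat ω p (exteriorPower.ιMulti ℝ p w) = flatVec ω w := by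
      ext u; rw [flat_ιMulti, flatVec_apply]
    change contract h (vol n ω) (exteriorPower.ιMulti ℝ p w) = (-1 : ℝ) ^ (p.choose 2) •
      expExp n ω (Pi.single p (flat ω p (exteriorPower.ιMulti ℝ p w))) q
    rw [h1, h2, contractVec_vol hE hω]
  rw [star, key]
  change (-1 : ℝ) ^ (p.choose 2) • expExp n ω (Pi.single p (flat ω p (sharp ω α))) q = _
  rw [flat_sharp hω]

/-- Induction on the codegree `q`, with `int_expExp` lowering it; this gives injectivity of the star
operator without computing its square. -/
theorem expExp_single_injective {n : ℕ} (hE : Module.finrank ℝ E = 2 * n) {ω : AltForm E 2}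
    (hω : Nondegenerate ω) {p q : ℕ} (h : p + q = 2 * n) (α : AltForm E p)
    (hα : expExp n ω (Pi.single p α) q = 0) : α = 0 := by
  have T := lefschetzTriple hE hω
  induction q generalizing p with
  | zero =>
    obtain rfl : p = 2 * n := by omega
    have w0 : Graded.weight (AltForm E) n (Pi.single (2 * n) α) =
        ((n : ℤ) : ℝ) • (Pi.single (2 * n) α : ∀ k, AltForm E k) :=
      Graded.weight_single (by push_cast; ring) α
    have wneg : (-Graded.weight (AltForm E) n) (Pi.single (2 * n) α) =
        ((-n : ℤ) : ℝ) • (Pi.single (2 * n) α : ∀ k, AltForm E k) := by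
      rw [LinearMap.neg_apply, w0]; simp
    have wj := fun j => T.swap.weight_L_pow wneg j
    have wj' : ∀ j : ℕ, Graded.weight (AltForm E) n ((dualLefschetz ω ^ j) (Pi.single (2 * n) α)) =
        ((n : ℝ) - 2 * j) • (dualLefschetz ω ^ j) (Pi.single (2 * n) α) := fun j => by
      have := wj j
      rw [LinearMap.neg_apply, neg_eq_iff_eq_neg, ← neg_smul] at this
      rw [this]
      congr 1; push_cast; ring
    have e1 : ∀ (y : ∀ k, AltForm E k), truncExp (n + 1) (lefschetz ω) y 0 = y 0 := fun y => by
      rw [truncExp_apply, Finset.sum_range_succ', Pi.add_apply, Finset.sum_apply,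
        Finset.sum_eq_zero]
      · simp
      · intro j _
        rw [pow_succ', Module.End.mul_apply, Pi.smul_apply, lefschetz, Graded.raiseTwo_zero,
          smul_zero]
    -- In degree zero `e^L` acts as the identity, and among the powers of `Λ` only `Λ^n` maps degree
    -- `2 * n` to degree zero.
    have e2 : (dualLefschetz ω ^ n) (Pi.single (2 * n) α) 0 = 0 := by
      rw [expExp, Module.End.mul_apply, e1, truncExp_apply, Finset.sum_apply,
        Finset.sum_eq_single_of_mem n (by simp)] at hα
      · rw [Pi.smul_apply] at hα
        exact (smul_eq_zero.1 hα).resolve_left (by positivity)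
      · intro j _ hj
        rw [Pi.smul_apply, Graded.weight_eq_smul_iff.1 (wj' j) 0, smul_zero]
        intro e
        apply hj
        have : (j : ℝ) = n := by push_cast at e; linarith
        exact_mod_cast this
    have e3 : (dualLefschetz ω ^ n) (Pi.single (2 * n) α) = 0 := by
      rw [Graded.eq_single (k := 0) (by push_cast; ring) (wj' n), e2, Pi.single_zero]
    have e4 := T.swap.eq_zero_of_pow_apply le_rfl wneg e3
    simpa using congrFun e4 (2 * n)
  | succ q ih =>
    -- Contracting the vanishing component with `v` shows, by induction, that `ω(v, ·) ∧ α = 0`.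
    -- These covectors exhaust the dual space.
    have h1 : ∀ v, extMul (bil ω v) p α = 0 := fun v => by
      refine ih (by omega) _ ?_
      rw [← Graded.raise_single]
      change expExp n ω (ext (bil ω v) _) q = 0
      rw [← int_expExp hE hω, int_apply, hα]
      rfl
    have h2 : ∀ θ, ext θ (Pi.single p α) = 0 := fun θ => by
      rw [← bil_vecSharp hω θ]
      change Graded.raise _ _ = 0
      rw [Graded.raise_single, h1, Pi.single_zero]
    let b := Module.finBasis ℝ E
    -- Since every `θ ∧ α` vanishes, each `e^a ∧ ι_{e_a} α` equals `α`. Their sum is `2 * n` times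
    -- `α`, but also `p` times `α`, and `p < 2 * n`.
    have h3 : ∀ a, (ext (coordL b a) * int (b a)) (Pi.single p α) = Pi.single p α := fun a => by
      have := LinearMap.congr_fun (int_mul_ext (b a) (coordL b a)) (Pi.single p α)
      rw [Module.End.mul_apply, h2, map_zero] at this
      have h1 : coordL b a (b a) = 1 := by simp [coordL]
      rw [h1, one_smul, LinearMap.sub_apply, Module.End.one_apply] at this
      exact (sub_eq_zero.1 this.symm).symm
    have h4 := LinearMap.congr_fun (sum_ext_mul_int b) (Pi.single p α)
    rw [LinearMap.sum_apply] at h4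
    simp only [h3, Finset.sum_const, Finset.card_univ, Fintype.card_fin, hE] at h4
    have h5 := congrFun h4 p
    rw [Graded.weight_apply, Pi.smul_apply, Pi.single_eq_same, ← Nat.cast_smul_eq_nsmul ℝ,
      ← sub_eq_zero, ← sub_smul] at h5
    refine (smul_eq_zero.1 h5).resolve_left ?_
    have : (2 * n : ℕ) = ((p : ℝ) + (q + 1)) := by exact_mod_cast h.symm
    rw [this]
    push_cast
    have : (0 : ℝ) < q + 1 := by positivity
    intro h0
    linarith

end AltForm

/-- Conjugation of `d` with `e^L e^Λ`, for `d` of weight one which commutes with `L`. -/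
theorem LefschetzTriple.apply_expExp {M : Type*} [AddCommGroup M] [Module ℝ M] {n : ℕ}
    {L Λ H d : Module.End ℝ M} (T : LefschetzTriple n L Λ H) (hd : H * d = d * H + d)
    (hL : d * L = L * d) {x : M} (hx : d x = 0) :
    d ((truncExp (n + 1) L * truncExp (n + 1) Λ) x) =
      (truncExp (n + 1) L * truncExp (n + 1) Λ) (d (Λ x)) := by
  have h1 := mul_truncExp (B := 0) T.pow_eq_zero (by rw [hL, add_zero]) (by simp)
  have h2 := mul_truncExp (D := d) (B := d * Λ - Λ * d) T.swap.pow_eq_zero (by abel)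
    (T.Λ_bracket hd hL).symm
  have := LinearMap.congr_fun (show d * (truncExp (n + 1) L * truncExp (n + 1) Λ) =
    truncExp (n + 1) L * truncExp (n + 1) Λ * (d + (d * Λ - Λ * d)) by
      rw [← mul_assoc, h1, add_zero, mul_assoc, h2, mul_assoc]) x
  simp only [Module.End.mul_apply, LinearMap.add_apply, LinearMap.sub_apply, hx, map_zero, sub_zero,
    zero_add] at this
  exact this

namespace AltForm

variable {E E' : Type*} [NormedAddCommGroup E] [NormedSpace ℝ E] [FiniteDimensional ℝ E]
  [NormedAddCommGroup E'] [NormedSpace ℝ E'] [FiniteDimensional ℝ E']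

/-! ### Naturality and smoothness of the dual Lefschetz operator -/

/-- The isomorphism carries a basis of `E'` to a basis of `E` and intertwines the maps `vecSharp`;
`sum_bilin_basis` permits this change of basis. -/
theorem dualLefschetzL_pullback {ω : AltForm E 2} (hω : Nondegenerate ω) (f : E' ≃L[ℝ] E) {k : ℕ}
    (α : AltForm E (k + 2)) :
    (dualLefschetzL ω k α).compContinuousLinearMap (f : E' →L[ℝ] E) =
      dualLefschetzL (ω.compContinuousLinearMap (f : E' →L[ℝ] E)) k
        (α.compContinuousLinearMap (f : E' →L[ℝ] E)) := by
  have hbil : ∀ u v, bil (ω.compContinuousLinearMap (f : E' →L[ℝ] E)) u v = bil ω (f u) (f v) :=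
    fun u v => by
      rw [bil_apply, bil_apply, ContinuousAlternatingMap.compContinuousLinearMap_apply]
      congr 1
      funext i; fin_cases i <;> rfl
  have hω' : Nondegenerate (ω.compContinuousLinearMap (f : E' →L[ℝ] E)) := fun u hu => by
    refine f.map_eq_zero_iff.1 (hω (f u) fun w => ?_)
    rw [← bil_apply, ← f.apply_symm_apply w, ← hbil, bil_apply]
    exact hu _
  let g : (E →L[ℝ] ℝ) →ₗ[ℝ] E →ₗ[ℝ] AltForm E k := LinearMap.mk₂ ℝ
    (fun θ v => (α.curryLeft v).curryLeft (vecSharp ω θ))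
    (fun θ η v => by simp) (fun c θ v => by simp)
    (fun θ u v => by simp) (fun c θ v => by simp)
  let b := Module.finBasis ℝ E'
  have key := sum_bilin_basis g (Module.finBasis ℝ E) (b.map f.toLinearEquiv)
  have hs : ∀ a, vecSharp ω (coordL (b.map f.toLinearEquiv) a) =
      f (vecSharp (ω.compContinuousLinearMap (f : E' →L[ℝ] E)) (coordL b a)) := fun a => by
    have : bil ω (f (vecSharp (ω.compContinuousLinearMap (f : E' →L[ℝ] E)) (coordL b a))) =
        coordL (b.map f.toLinearEquiv) a := by
      ext w
      rw [← f.apply_symm_apply w, ← hbil, bil_vecSharp hω']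
      simp [coordL]
    rw [← this, vecSharp_bil hω]
  simp only [g, LinearMap.mk₂_apply, hs, Module.Basis.map_apply] at key
  rw [dualLefschetzL_apply, key, dualLefschetzL_apply]
  simp only [ContinuousAlternatingMap.curryLeft_compContinuousLinearMap]
  ext u
  simp only [ContinuousAlternatingMap.compContinuousLinearMap_apply,
    ContinuousAlternatingMap.smul_apply, ContinuousAlternatingMap.sum_apply]
  rfl

theorem dualLefschetzL_pullback_of_injective {ω : AltForm E 2} (hω : Nondegenerate ω)
    {f : E →L[ℝ] E} (hf : Function.Injective f) {k : ℕ} (α : AltForm E (k + 2)) :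
    (dualLefschetzL ω k α).compContinuousLinearMap f =
      dualLefschetzL (ω.compContinuousLinearMap f) k (α.compContinuousLinearMap f) :=
  dualLefschetzL_pullback hω (LinearEquiv.ofInjectiveEndo f.toLinearMap hf).toContinuousLinearEquiv α

omit [FiniteDimensional ℝ E] [FiniteDimensional ℝ E'] in
theorem injective_of_nondegenerate {ω : AltForm E 2} {f : E' →L[ℝ] E}
    (h : Nondegenerate (ω.compContinuousLinearMap f)) : Function.Injective f := by
  refine (injective_iff_map_eq_zero f).2 fun v hv => h v fun w => ?_
  rw [ContinuousAlternatingMap.compContinuousLinearMap_apply]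
  exact ω.map_coord_zero 0 hv

-- Everything is linear in the data except `vecSharp`, and inversion of operators is smooth at
-- invertible ones.
omit [FiniteDimensional ℝ E'] in
open scoped ContDiff in
theorem contDiffOn_dualLefschetzL {V : Set E'} {σ : E' → AltForm E 2} {k : ℕ}
    {α : E' → AltForm E (k + 2)} (hσ : ContDiffOn ℝ ∞ σ V) (hα : ContDiffOn ℝ ∞ α V)
    (hn : ∀ x ∈ V, Nondegenerate (σ x)) :
    ContDiffOn ℝ ∞ (fun x => dualLefschetzL (σ x) k (α x)) V := by
  have hs : ContDiffOn ℝ ∞ (fun x => vecSharp (σ x)) V := fun x hx => by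
    refine ContDiffAt.comp_contDiffWithinAt x ?_
      ((bil (E := E)).contDiff.comp_contDiffOn hσ x hx)
    change ContDiffAt ℝ ∞ _ (bil (σ x))
    rw [← coe_bilEquiv (hn x hx)]
    exact contDiffAt_map_inverse _
  have hc : ∀ {m : ℕ} {β : E' → AltForm E (m + 1)} {v : E' → E}, ContDiffOn ℝ ∞ β V →
      ContDiffOn ℝ ∞ v V → ContDiffOn ℝ ∞ (fun x => (β x).curryLeft (v x)) V :=
    fun hβ hv => ((ContinuousAlternatingMap.curryLeftLI
      (𝕜 := ℝ) (E := E) (F := ℝ)).toContinuousLinearMap.contDiff.comp_contDiffOn hβ).clm_apply hv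
  simp only [dualLefschetzL_apply]
  exact (ContDiffOn.sum fun a _ => hc (hc hα contDiffOn_const)
    (hs.clm_apply contDiffOn_const)).const_smul _

end AltForm

/-! ### The `sl₂`-action on the forms of an orbifold -/

namespace Orbifold

variable {m n : ℕ} {X : Type v} [TopologicalSpace X] [T2Space X] [SecondCountableTopology X]

open UniformizingSystem

omit [T2Space X] [SecondCountableTopology X] in
theorem _root_.UniformizingSystem.Injection.fderiv_injective {A B : UniformizingSystem.{u} m X}
    (a : A.Injection B) {x : Model m} (hx : x ∈ A.V) :
    Function.Injective (fderiv ℝ a.φ x) := by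
  have hx' : x ∈ a.φ.source := a.source_eq ▸ hx
  have h1 : DifferentiableAt ℝ a.φ x :=
    (a.smooth.contDiffAt (a.φ.open_source.mem_nhds hx')).differentiableAt (by simp)
  have h2 : DifferentiableAt ℝ a.φ.symm (a.φ x) :=
    (a.smooth_symm.contDiffAt (a.φ.open_target.mem_nhds (a.φ.map_source hx'))).differentiableAt
      (by simp)
  have h3 := h2.hasFDerivAt.comp x h1.hasFDerivAt
  have h4 : HasFDerivAt (a.φ.symm ∘ a.φ) (ContinuousLinearMap.id ℝ (Model m)) x :=
    (hasFDerivAt_id x).congr_of_eventuallyEq (a.φ.eventually_left_inverse hx')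
  have h5 := h3.unique h4
  exact Function.LeftInverse.injective (g := fderiv ℝ a.φ.symm (a.φ x)) fun v =>
    congrArg (fun f : Model m →L[ℝ] Model m => f v) h5

namespace SymplecticForm

variable {𝒳 : Orbifold.{u, v, w} m X}

/-- The dual Lefschetz operator on forms. -/
noncomputable def dualWedge (ω : 𝒳.SymplecticForm) (k : ℕ) : 𝒳.Form (k + 2) →ₗ[ℝ] 𝒳.Form k where
  toFun s := ⟨fun i x => AltForm.dualLefschetzL (ω.form.1 i x) k (s.1 i x), by
    refine ⟨fun i => ?_, fun i x hx => ?_, fun i g x hx => ?_, fun i j W a b x hx => ?_⟩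
    · exact AltForm.contDiffOn_dualLefschetzL (ω.form.2.1 i) (s.2.1 i) (ω.nondegenerate i)
    · change AltForm.dualLefschetzL (ω.form.1 i x) k (s.1 i x) = 0
      rw [s.2.2.1 i x hx, map_zero]
    · have h := ω.form.2.2.2.1 i g x hx
      -- Invariance of `ω` suffices here: the pullback of `ω` under the derivative of the action is
      -- `ω` itself, which is nondegenerate.
      have hi : Function.Injective (fderiv ℝ ((𝒳.chart i).act g) x) :=
        AltForm.injective_of_nondegenerate (ω := ω.form.1 i ((𝒳.chart i).act g x)) (by
          have := ω.nondegenerate i x hx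
          rwa [← h] at this)
      rw [formPullback, AltForm.dualLefschetzL_pullback_of_injective
        (ω.nondegenerate i _ ((𝒳.chart i).act_mem g x hx)) hi]
      exact congrArg₂ (fun a b => AltForm.dualLefschetzL a k b) h (s.2.2.2.1 i g x hx)
    · have mem : ∀ {i} (a : W.Injection (𝒳.chart i)), a.φ x ∈ (𝒳.chart i).V := fun a =>
        a.target_subset (a.φ.map_source (a.source_eq ▸ hx))
      rw [formPullback, formPullback, AltForm.dualLefschetzL_pullback_of_injective
        (ω.nondegenerate i _ (mem a)) (a.fderiv_injective hx),
        AltForm.dualLefschetzL_pullback_of_injective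
        (ω.nondegenerate j _ (mem b)) (b.fderiv_injective hx)]
      exact congrArg₂ (fun a b => AltForm.dualLefschetzL a k b) (ω.form.2.2.2.2 i j W a b x hx)
        (s.2.2.2.2 i j W a b x hx)⟩
  map_add' s t := by
    ext1
    funext i x
    exact (AltForm.dualLefschetzL (ω.form.1 i x) k).map_add _ _
  map_smul' c s := by
    ext1
    funext i x
    exact (AltForm.dualLefschetzL (ω.form.1 i x) k).map_smul _ _

/-- `α ↦ ω ∧ α` on the space of all forms on an orbifold. -/
noncomputable def lefschetz (ω : 𝒳.SymplecticForm) : Module.End ℝ (∀ k, 𝒳.Form k) :=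
  Graded.raiseTwo ω.wedge

/-- The dual Lefschetz operator on the space of all forms on an orbifold. -/
noncomputable def dualLefschetz (ω : 𝒳.SymplecticForm) : Module.End ℝ (∀ k, 𝒳.Form k) :=
  Graded.lower 2 ω.dualWedge

end SymplecticForm

/-- The exterior derivative on the space of all forms. -/
noncomputable def deriv (𝒳 : Orbifold.{u, v, w} m X) : Module.End ℝ (∀ k, 𝒳.Form k) :=
  Graded.raise 𝒳.d

/-- The value of forms at a point of a chart. -/
def evalAt (𝒳 : Orbifold.{u, v, w} m X) (i : 𝒳.ι) (x : Model m) :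
    (∀ k, 𝒳.Form k) →ₗ[ℝ] ∀ k, AltForm (Model m) k where
  toFun s k := (s k).1 i x
  map_add' _ _ := rfl
  map_smul' _ _ := rfl

/-- Forms are zero outside the chart domains by convention, so identities without derivatives reduce
to linear algebra at each point. -/
theorem ext_evalAt {𝒳 : Orbifold.{u, v, w} m X} {s t : ∀ k, 𝒳.Form k}
    (h : ∀ i, ∀ x ∈ (𝒳.chart i).V, 𝒳.evalAt i x s = 𝒳.evalAt i x t) : s = t := by
  funext k
  ext1
  funext i x
  by_cases hx : x ∈ (𝒳.chart i).V
  · exact congrFun (h i x hx) k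
  · rw [(s k).2.2.1 i x hx, (t k).2.2.1 i x hx]

theorem evalAt_single (𝒳 : Orbifold.{u, v, w} m X) (i : 𝒳.ι) (x : Model m) {k : ℕ} (s : 𝒳.Form k) :
    𝒳.evalAt i x (Pi.single k s) = Pi.single k (s.1 i x) := by
  funext j
  change ((Pi.single k s : ∀ k, 𝒳.Form k) j).1 i x = _
  by_cases h : j = k
  · subst h; simp
  · rw [Pi.single_eq_of_ne h, Pi.single_eq_of_ne h]; rfl

namespace SymplecticForm

section

variable {𝒳 : Orbifold.{u, v, w} m X} (ω : 𝒳.SymplecticForm)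

theorem evalAt_lefschetz (i : 𝒳.ι) (x : Model m) (s : ∀ k, 𝒳.Form k) :
    𝒳.evalAt i x (ω.lefschetz s) = AltForm.lefschetz (ω.form.1 i x) (𝒳.evalAt i x s) := by
  funext k
  match k with
  | 0 => rfl
  | 1 => rfl
  | k + 2 => rfl

theorem evalAt_dualLefschetz (i : 𝒳.ι) (x : Model m) (s : ∀ k, 𝒳.Form k) :
    𝒳.evalAt i x (ω.dualLefschetz s) = AltForm.dualLefschetz (ω.form.1 i x) (𝒳.evalAt i x s) := rfl

theorem deriv_mul_lefschetz : 𝒳.deriv * ω.lefschetz = ω.lefschetz * 𝒳.deriv := by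
  refine LinearMap.ext fun s => funext fun k => ?_
  match k with
  | 0 => rfl
  | 1 => exact map_zero (𝒳.d 0)
  | 2 =>
    change 𝒳.d 1 0 = ω.wedge 0 0
    rw [map_zero, map_zero]
  | k + 3 => exact d_wedge ω (s k)

theorem deriv_mul_deriv (𝒳 : Orbifold.{u, v, w} m X) : 𝒳.deriv * 𝒳.deriv = 0 := by
  refine LinearMap.ext fun s => funext fun k => ?_
  match k with
  | 0 => rfl
  | 1 => exact map_zero (𝒳.d 0)
  | k + 2 => exact d_comp_d 𝒳 (s k)

end

variable {𝒳 : Orbifold.{u, v, w} (2 * n) X} (ω : 𝒳.SymplecticForm)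

theorem form_eq_zero {k : ℕ} (hk : 2 * n < k) (s : 𝒳.Form k) : s = 0 := by
  ext1
  funext i x
  exact AltForm.eq_zero_of_finrank_lt (by simpa using hk) _

theorem lefschetzTriple :
    LefschetzTriple n ω.lefschetz ω.dualLefschetz (Graded.weight (fun k => 𝒳.Form k) n) := by
  refine Graded.lefschetzTriple (fun k hk x => form_eq_zero hk x) _ _ ?_
  change ω.dualLefschetz * ω.lefschetz = ω.lefschetz * ω.dualLefschetz + _
  refine LinearMap.ext fun s => ext_evalAt fun i x hx => ?_
  have := LinearMap.congr_fun
    (AltForm.lefschetzTriple (n := n) (by simp) (ω.nondegenerate i x hx)).Λ_mul_L (𝒳.evalAt i x s)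
  simp only [Module.End.mul_apply, LinearMap.add_apply, evalAt_lefschetz, evalAt_dualLefschetz,
    map_add] at this ⊢
  rw [this]
  rfl

/-- The operator `e^L e^Λ`. -/
noncomputable def expExp : Module.End ℝ (∀ k, 𝒳.Form k) :=
  truncExp (n + 1) ω.lefschetz * truncExp (n + 1) ω.dualLefschetz

theorem evalAt_expExp (i : 𝒳.ι) (x : Model (2 * n)) (s : ∀ k, 𝒳.Form k) :
    𝒳.evalAt i x (ω.expExp s) = AltForm.expExp n (ω.form.1 i x) (𝒳.evalAt i x s) := by
  rw [expExp, AltForm.expExp, Module.End.mul_apply, Module.End.mul_apply,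
    map_truncExp _ (ω.evalAt_lefschetz i x), map_truncExp _ (ω.evalAt_dualLefschetz i x)]

/-- The algebraic core of Koszul's formula, before restriction to a single degree. -/
theorem deriv_expExp {s : ∀ k, 𝒳.Form k} (hs : 𝒳.deriv s = 0) :
    𝒳.deriv (ω.expExp s) = ω.expExp (𝒳.deriv (ω.dualLefschetz s)) :=
  ω.lefschetzTriple.apply_expExp (Graded.weight_mul_raise n 𝒳.d) ω.deriv_mul_lefschetz hs

end SymplecticForm

end Orbifold

/-! ### Koszul's formula and harmonic forms on an orbifold -/

theorem Graded.raise_lower_single {F : ℕ → Type*} [∀ k, AddCommGroup (F k)] [∀ k, Module ℝ (F k)]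
    (f : ∀ k, F k →ₗ[ℝ] F (k + 1)) (g : ∀ k, F (k + 2) →ₗ[ℝ] F k) {j : ℕ} (x : F (j + 1)) :
    raise f (lower 2 g (Pi.single (j + 1) x)) =
      Pi.single j (raise f (lower 2 g (Pi.single (j + 1) x)) j) := by
  funext k
  by_cases hk : k = j
  · subst hk; simp
  · rw [Pi.single_eq_of_ne hk]
    cases k with
    | zero => rfl
    | succ k => rw [raise_succ, lower_apply, Pi.single_eq_of_ne (by omega), map_zero, map_zero]

namespace AltForm

theorem star_eq_zero_iff {E : Type*} [NormedAddCommGroup E] [NormedSpace ℝ E]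
    [FiniteDimensional ℝ E] {n : ℕ} (hE : Module.finrank ℝ E = 2 * n) {ω : AltForm E 2}
    (hω : Nondegenerate ω) {p q : ℕ} (h : p + q = 2 * n) (α : AltForm E p) :
    star n h ω α = 0 ↔ α = 0 := by
  rw [star_eq hE hω, smul_eq_zero, or_iff_right (pow_ne_zero _ (by norm_num))]
  refine ⟨expExp_single_injective hE hω h α, fun e => ?_⟩
  rw [e, Pi.single_zero, map_zero]
  rfl

end AltForm

namespace Orbifold

variable {n : ℕ} {X : Type v} [TopologicalSpace X] [T2Space X] [SecondCountableTopology X]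
  {𝒳 : Orbifold.{u, v, w} (2 * n) X}

open LefschetzTriple (harmonic mem_harmonic)

theorem deriv_single {k : ℕ} (s : 𝒳.Form k) :
    𝒳.deriv (Pi.single k s) = Pi.single (k + 1) (𝒳.d k s) := Graded.raise_single _ _ _

theorem deriv_single_eq_zero_iff {k : ℕ} (s : 𝒳.Form k) :
    𝒳.deriv (Pi.single k s) = 0 ↔ 𝒳.d k s = 0 := by
  rw [deriv_single, Pi.single_eq_zero_iff]

/-- Describes exactness by weights uniformly in `k`. In degree zero it agrees with the convention
that only `0` is exact, as `deriv` has no component there. -/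
theorem mem_exactForms_iff {k : ℕ} (s : 𝒳.Form k) :
    s ∈ 𝒳.exactForms k ↔ ∃ z : ∀ j, 𝒳.Form j,
      Graded.weight (fun k => 𝒳.Form k) n z = ((k - n - 1 : ℤ) : ℝ) • z ∧
        𝒳.deriv z = Pi.single k s := by
  cases k with
  | zero =>
    constructor
    · intro h
      have h : s = 0 := h
      exact ⟨0, by simp, by simp [h]⟩
    · rintro ⟨z, -, hz⟩
      have := congrFun hz 0
      rw [Pi.single_eq_same] at this
      exact this.symm
  | succ k =>
    constructor
    · rintro ⟨t, rfl⟩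
      exact ⟨Pi.single k t, Graded.weight_single (F := fun k => 𝒳.Form k) (by push_cast; ring) t,
        deriv_single t⟩
    · rintro ⟨z, -, hz⟩
      have := congrFun hz (k + 1)
      rw [Pi.single_eq_same] at this
      exact ⟨z k, this⟩

theorem cohomologyClass_eq_iff {k : ℕ} (s t : 𝒳.closedForms k) :
    𝒳.cohomologyClass k s = 𝒳.cohomologyClass k t ↔ s.1 - t.1 ∈ 𝒳.exactForms k :=
  Submodule.Quotient.eq _

namespace SymplecticForm

variable (ω : 𝒳.SymplecticForm)

/-- Koszul's formula `d ⋆ ξ = ± ⋆ d Λ ξ` for a closed form `ξ`. -/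
theorem extDeriv_star {j q : ℕ} (h : j + 1 + q = 2 * n) (h' : j + (q + 1) = 2 * n)
    {s : 𝒳.Form (j + 1)} (hs : 𝒳.d (j + 1) s = 0) {i : 𝒳.ι} {x : Model (2 * n)}
    (hx : x ∈ (𝒳.chart i).V) :
    extDeriv (fun y => AltForm.star n h (ω.form.1 i y) (s.1 i y)) x =
      (-1 : ℝ) ^ j • AltForm.star n h' (ω.form.1 i x)
        ((𝒳.deriv (ω.dualLefschetz (Pi.single (j + 1) s)) j).1 i x) := by
  have hE : Module.finrank ℝ (Model (2 * n)) = 2 * n := by simp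
  set ξ : ∀ k, 𝒳.Form k := Pi.single (j + 1) s with hξ
  have dξ : 𝒳.deriv ξ = 0 := (deriv_single_eq_zero_iff s).2 hs
  have e1 : ∀ y ∈ (𝒳.chart i).V, AltForm.star n h (ω.form.1 i y) (s.1 i y) =
      (-1 : ℝ) ^ (j + 1).choose 2 • (ω.expExp ξ q).1 i y := fun y hy => by
    rw [AltForm.star_eq hE (ω.nondegenerate i y hy), ← evalAt_single, ← ω.evalAt_expExp]
    rfl
  -- The exterior derivative needs equality near `x`, which holds because the chart domain is open.
  have e2 : (fun y => AltForm.star n h (ω.form.1 i y) (s.1 i y)) =ᶠ[nhds x]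
      (-1 : ℝ) ^ (j + 1).choose 2 • (ω.expExp ξ q).1 i :=
    Filter.eventually_of_mem ((𝒳.chart i).isOpen_V.mem_nhds hx) e1
  have hsingle : 𝒳.deriv (ω.dualLefschetz ξ) = Pi.single j (𝒳.deriv (ω.dualLefschetz ξ) j) :=
    Graded.raise_lower_single 𝒳.d ω.dualWedge s
  rw [e2.extDeriv_eq, extDeriv_smul, ← d_apply 𝒳 _ hx]
  change (-1 : ℝ) ^ (j + 1).choose 2 • (𝒳.deriv (ω.expExp ξ) (q + 1)).1 i x = _
  -- The signs of the star operators in degrees `j + 1` and `j` differ by `(-1)^j`, by Pascal's rule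
  -- for the exponents.
  rw [ω.deriv_expExp dξ, AltForm.star_eq hE (ω.nondegenerate i x hx), ← evalAt_single,
    ← hsingle, ← ω.evalAt_expExp, smul_smul, Nat.choose_succ_succ, Nat.choose_one_right, pow_add]
  rfl

/-- For closed `s` Koszul's formula turns `δ s` into `± ⋆ ⋆ d Λ s`, and both star operators are
injective. -/
theorem isHarmonic_iff {k : ℕ} (s : 𝒳.Form k) :
    ω.IsHarmonic s ↔ (Pi.single k s : ∀ k, 𝒳.Form k) ∈ harmonic ω.dualLefschetz 𝒳.deriv := by
  rw [IsHarmonic, mem_harmonic, deriv_single_eq_zero_iff]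
  refine and_congr_right fun hs => ?_
  cases k with
  | zero =>
    have : ω.dualLefschetz (Pi.single 0 s) = 0 := by
      refine funext fun k => ?_
      rw [dualLefschetz, Graded.lower_apply, Pi.single_eq_of_ne (by omega), map_zero]
      rfl
    simp [this, IsCoclosed]
  | succ j =>
    by_cases hj : j + 1 ≤ 2 * n
    · have hE : Module.finrank ℝ (Model (2 * n)) = 2 * n := by simp
      have h1 : ω.IsCoclosed s ↔ ∀ i, ∀ x ∈ (𝒳.chart i).V,
          (𝒳.deriv (ω.dualLefschetz (Pi.single (j + 1) s)) j).1 i x = 0 := by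
        refine forall_congr' fun i => forall_congr' fun x => forall_congr' fun hx => ?_
        rw [AltForm.codiff, dif_pos hj, smul_eq_zero, or_iff_right (pow_ne_zero _ (by norm_num)),
          AltForm.star_eq_zero_iff hE (ω.nondegenerate i x hx),
          ω.extDeriv_star _ (by omega) hs hx, smul_eq_zero,
          or_iff_right (pow_ne_zero _ (by norm_num)),
          AltForm.star_eq_zero_iff hE (ω.nondegenerate i x hx)]
      rw [h1]
      constructor
      · intro h
        have h2 : 𝒳.deriv (ω.dualLefschetz (Pi.single (j + 1) s)) j = 0 := by
          ext1
          funext i x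
          by_cases hx : x ∈ (𝒳.chart i).V
          · exact h i x hx
          · exact (𝒳.deriv (ω.dualLefschetz (Pi.single (j + 1) s)) j).2.2.1 i x hx
        have h3 := Graded.raise_lower_single 𝒳.d ω.dualWedge s
        change 𝒳.deriv (ω.dualLefschetz (Pi.single (j + 1) s)) =
          Pi.single j (𝒳.deriv (ω.dualLefschetz (Pi.single (j + 1) s)) j) at h3
        rw [h3, h2, Pi.single_zero]
      · intro h i x _
        rw [h]
        rfl
    -- Above degree `2n` the default value of `codiff` is harmless, since there are no nonzero
    -- forms.
    · have h0 : s = 0 := form_eq_zero (by omega) s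
      have h1 : ω.IsCoclosed s := fun i x _ => by rw [AltForm.codiff, dif_neg hj]
      refine iff_of_true h1 ?_
      rw [h0, Pi.single_zero, map_zero, map_zero]

end SymplecticForm

end Orbifold

/-! ### From weight vectors to cohomology classes -/

theorem Graded.eq_zero_or_single {F : ℕ → Type*} [∀ k, AddCommGroup (F k)] [∀ k, Module ℝ (F k)]
    {n : ℕ} {r : ℤ} {x : ∀ k, F k} (hx : weight F n x = (r : ℝ) • x) :
    x = 0 ∨ ∃ k : ℕ, (k - n : ℤ) = r ∧ ∃ s : F k, x = Pi.single k s := by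
  by_cases h : ∃ k : ℕ, (k - n : ℤ) = r
  · obtain ⟨k, hk⟩ := h
    exact Or.inr ⟨k, hk, x k, eq_single (by rw [← hk]; push_cast; ring) hx⟩
  · refine Or.inl (funext fun k => weight_eq_smul_iff.1 hx k fun e => h ⟨k, ?_⟩)
    exact_mod_cast e

namespace Orbifold

variable {n : ℕ} {X : Type v} [TopologicalSpace X] [T2Space X] [SecondCountableTopology X]
  {𝒳 : Orbifold.{u, v, w} (2 * n) X}

open LefschetzTriple (harmonic mem_harmonic)

theorem weight_single {k : ℕ} (s : 𝒳.Form k) : Graded.weight (fun k => 𝒳.Form k) n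
    (Pi.single k s) = ((k - n : ℤ) : ℝ) • (Pi.single k s : ∀ k, 𝒳.Form k) :=
  Graded.weight_single (F := fun k => 𝒳.Form k) (by push_cast; rfl) s

namespace SymplecticForm

variable (ω : 𝒳.SymplecticForm)

set_option maxHeartbeats 400000 in
/-- The existence of harmonic representatives in terms of the space of all forms. -/
theorem exists_harmonic_iff :
    (∀ (k : ℕ) (c : 𝒳.Cohomology k),
        ∃ ξ : 𝒳.closedForms k, ω.IsHarmonic ξ.1 ∧ 𝒳.cohomologyClass k ξ = c) ↔
      ∀ (r : ℤ) (x : ∀ k, 𝒳.Form k), Graded.weight (fun k => 𝒳.Form k) n x = (r : ℝ) • x →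
        𝒳.deriv x = 0 → ∃ h z, Graded.weight (fun k => 𝒳.Form k) n h = (r : ℝ) • h ∧
          Graded.weight (fun k => 𝒳.Form k) n z = ((r - 1 : ℤ) : ℝ) • z ∧
          h ∈ harmonic ω.dualLefschetz 𝒳.deriv ∧ x = h + 𝒳.deriv z := by
  constructor
  · intro H r x hx dx
    -- An integer weight below `-n` belongs to no degree, and then the vector is zero.
    obtain rfl | ⟨k, rfl, s, rfl⟩ := Graded.eq_zero_or_single hx
    · exact ⟨0, 0, by simp, by simp, zero_mem _, by simp⟩
    · have ds : s ∈ 𝒳.closedForms k := (deriv_single_eq_zero_iff s).1 dx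
      obtain ⟨t, ht, e⟩ := H k (𝒳.cohomologyClass k ⟨s, ds⟩)
      obtain ⟨z, wz, hz⟩ := (mem_exactForms_iff _).1 ((cohomologyClass_eq_iff _ _).1 e.symm)
      refine ⟨Pi.single k t.1, z, weight_single t.1, wz, (ω.isHarmonic_iff t.1).1 ht, ?_⟩
      rw [hz, ← Pi.single_add]
      congr 1
      exact (add_sub_cancel _ _).symm
  · intro H k c
    obtain ⟨s, rfl⟩ := Submodule.mkQ_surjective _ c
    obtain ⟨h, z, wh, wz, hh, e⟩ := H (k - n) (Pi.single k s.1) (weight_single s.1)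
      ((deriv_single_eq_zero_iff s.1).2 s.2)
    have hk : h = Pi.single k (h k) :=
      Graded.eq_single (F := fun k => 𝒳.Form k) (by push_cast; rfl) wh
    rw [hk] at hh
    have hh' := (ω.isHarmonic_iff (h k)).2 hh
    refine ⟨⟨h k, hh'.1⟩, hh', ?_⟩
    refine Eq.symm ((cohomologyClass_eq_iff s ⟨h k, hh'.1⟩).2 ((mem_exactForms_iff _).2 ⟨z, wz, ?_⟩))
    rw [Pi.single_sub, e, ← hk, add_sub_cancel_left]

theorem lefschetz_single {k : ℕ} (s : 𝒳.Form k) :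
    ω.lefschetz (Pi.single k s) = Pi.single (k + 2) (ω.wedge k s) := Graded.raiseTwo_single _ _ _

/-- A class and its image under `L^k` are compared through representatives in the total space, where
`L^k` is an honest power of one endomorphism. -/
theorem exists_Lpow_eq {p : ℕ} (s : 𝒳.closedForms p) (k : ℕ) :
    ∃ t : 𝒳.closedForms (p + 2 * k),
      (Pi.single (p + 2 * k) t.1 : ∀ k, 𝒳.Form k) = (ω.lefschetz ^ k) (Pi.single p s.1) ∧
        ω.Lpow p k (𝒳.cohomologyClass p s) = 𝒳.cohomologyClass (p + 2 * k) t := by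
  induction k with
  | zero => exact ⟨s, rfl, rfl⟩
  | succ k ih =>
    obtain ⟨t, h1, h2⟩ := ih
    refine ⟨⟨ω.wedge (p + 2 * k) t.1, ω.wedge_mem_closedForms t.1 t.2⟩, ?_, ?_⟩
    · rw [pow_succ', Module.End.mul_apply, ← h1]
      exact (ω.lefschetz_single t.1).symm
    · change ω.L (p + 2 * k) (ω.Lpow p k (𝒳.cohomologyClass p s)) = _
      rw [h2]
      rfl

set_option maxHeartbeats 400000 in
theorem exists_pow_of_surjective_Lpow
    (H : ∀ k p : ℕ, p + k = n → Function.Surjective (ω.Lpow p k)) :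
    ∀ (k : ℕ) (x : ∀ k, 𝒳.Form k),
        Graded.weight (fun k => 𝒳.Form k) n x = ((k : ℤ) : ℝ) • x → 𝒳.deriv x = 0 →
        ∃ y z, Graded.weight (fun k => 𝒳.Form k) n y = ((-k : ℤ) : ℝ) • y ∧
          Graded.weight (fun k => 𝒳.Form k) n z = ((k - 1 : ℤ) : ℝ) • z ∧ 𝒳.deriv y = 0 ∧
          x = (ω.lefschetz ^ k) y + 𝒳.deriv z := by
  intro k x hx dx
  by_cases hk : n < k
  · rw [ω.lefschetzTriple.eq_zero_of_lt _ (by rw [Nat.abs_cast]; exact_mod_cast hk) x hx]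
    exact ⟨0, 0, by simp, by simp, by simp, by simp⟩
  obtain ⟨p, rfl⟩ : ∃ p, n = p + k := ⟨n - k, by omega⟩
  have hx' : x = Pi.single (p + 2 * k) (x (p + 2 * k)) :=
    Graded.eq_single (F := fun k => 𝒳.Form k) (by push_cast; ring) hx
  set s := x (p + 2 * k)
  have ds : s ∈ 𝒳.closedForms (p + 2 * k) := (deriv_single_eq_zero_iff s).1 (hx' ▸ dx)
  obtain ⟨c, hc⟩ := H k p rfl (𝒳.cohomologyClass _ ⟨s, ds⟩)
  obtain ⟨t, rfl⟩ := Submodule.mkQ_surjective _ c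
  obtain ⟨t', h1, h2⟩ := ω.exists_Lpow_eq t k
  have h3 := hc.symm.trans h2
  obtain ⟨z, wz, hz⟩ := (mem_exactForms_iff _).1 ((cohomologyClass_eq_iff _ _).1 h3)
  refine ⟨Pi.single p t.1, z, ?_, ?_, (deriv_single_eq_zero_iff t.1).2 t.2, ?_⟩
  · rw [weight_single]
    congr 2
    push_cast
    ring
  · rw [wz]
    congr 2
    push_cast
    ring
  · refine hx'.trans (Eq.trans ?_ (congrArg₂ (· + ·) h1 hz.symm))
    change _ = (Pi.single (p + 2 * k) t'.1 + Pi.single (p + 2 * k) (s - t'.1) : ∀ k, 𝒳.Form k)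
    rw [← Pi.single_add, add_sub_cancel]

set_option maxHeartbeats 400000 in
theorem surjective_Lpow_of_exists_pow
    (H : ∀ (k : ℕ) (x : ∀ k, 𝒳.Form k),
        Graded.weight (fun k => 𝒳.Form k) n x = ((k : ℤ) : ℝ) • x → 𝒳.deriv x = 0 →
        ∃ y z, Graded.weight (fun k => 𝒳.Form k) n y = ((-k : ℤ) : ℝ) • y ∧
          Graded.weight (fun k => 𝒳.Form k) n z = ((k - 1 : ℤ) : ℝ) • z ∧ 𝒳.deriv y = 0 ∧
          x = (ω.lefschetz ^ k) y + 𝒳.deriv z) :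
    ∀ k p : ℕ, p + k = n → Function.Surjective (ω.Lpow p k) := by
  intro k p hp c
  subst hp
  obtain ⟨s, rfl⟩ := Submodule.mkQ_surjective _ c
  have ws := weight_single s.1
  rw [show ((p + 2 * k : ℕ) : ℤ) - (p + k : ℕ) = k by push_cast; ring] at ws
  obtain ⟨y, z, wy, wz, dy, e⟩ := H k _ ws ((deriv_single_eq_zero_iff s.1).2 s.2)
  have hy : y = Pi.single p (y p) :=
    Graded.eq_single (F := fun k => 𝒳.Form k) (by push_cast; ring) wy
  set t := y p
  have dt : t ∈ 𝒳.closedForms p := (deriv_single_eq_zero_iff t).1 (hy ▸ dy)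
  obtain ⟨t', h1, h2⟩ := ω.exists_Lpow_eq ⟨t, dt⟩ k
  refine ⟨𝒳.cohomologyClass p ⟨t, dt⟩, h2.trans ?_⟩
  refine Eq.symm ((cohomologyClass_eq_iff s t').2 ((mem_exactForms_iff _).2 ⟨z, ?_, ?_⟩))
  · rw [wz]
    congr 2
    push_cast
    ring
  · have h3 : (ω.lefschetz ^ k) (Pi.single p t) = (ω.lefschetz ^ k) y := congrArg _ hy.symm
    have h4 := (congrArg (· + 𝒳.deriv z) (h1.trans h3)).trans e.symm
    exact (eq_sub_of_add_eq' h4).trans (Pi.single_sub (f := fun k => 𝒳.Form k) _ _ _).symm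

end SymplecticForm

end Orbifold

/-- Writing `p = n - k` as `p + k = n` avoids truncated subtraction; the target degree `p + 2 * k`
is then `n + k`. -/
theorem mainTheorem2 {n : ℕ} {X : Type v} [TopologicalSpace X] [T2Space X]
    [SecondCountableTopology X] (𝒳 : Orbifold.{u, v, w} (2 * n) X) (ω : 𝒳.SymplecticForm) :
    (∀ (k : ℕ) (c : 𝒳.Cohomology k),
        ∃ ξ : 𝒳.closedForms k, ω.IsHarmonic ξ.1 ∧ 𝒳.cohomologyClass k ξ = c) ↔
      ∀ k p : ℕ, p + k = n → Function.Surjective (ω.Lpow p k) := by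
  rw [ω.exists_harmonic_iff]
  refine Iff.trans ?_ ⟨ω.surjective_Lpow_of_exists_pow, ω.exists_pow_of_surjective_Lpow⟩
  exact ω.lefschetzTriple.harmonic_iff_surjective (Graded.weight_mul_raise n 𝒳.d)
    ω.deriv_mul_lefschetz (Orbifold.SymplecticForm.deriv_mul_deriv 𝒳)
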